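/- \textbf{Square-free semigroups.} A square-free semigroup is a semigroup $S$ with zero $\theta$ and a finite set $E\subseteq S$ of pairwise orthogonal nonzero idempotents such that $S=\bigcup_{e,f\in E}eSf$ and $|eSf\setminus\{\theta\}|\le 1$ for all $e,f\in E$. Put $S^*=S\setminus\{\theta\}$; each $s\in S^*$ satisfies $s=e\cdot s\cdot f$ for unique $e,f\in E$. Let $\mathrm{Aut}\,S$ be the group of semigroup automorphisms of $S$. \textbf{Cohomology.} Let $D$ be a division ring, $D^*$ its group of units, $\mathrm{Aut}(D)$ its group of ring automorphisms, and $\rho_d(x)=dxd^{-1}$. A 2-cocycle is a pair $(\alpha,\xi)$ with $\alpha:S^*\to\mathrm{Aut}(D)$ and $\xi:\{(s,t):s\cdot t\ne\theta\}\to D^*$ such that $\alpha_s(\xi(t,u))\,\xi(s,t\cdot u)=\xi(s,t)\,\xi(s\cdot t,u)$ whenever $s\cdot t\cdot u\neq\theta$, and $\alpha_s\circ\alpha_t=\rho_{\xi(s,t)}\circ\alpha_{s\cdot t}$ whenever $s\cdot t\ne\theta$. Let $G$ be the group of pairs $(\mu,\eta)$ with $\mu:E\to\mathrm{Aut}(D)$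 and $\eta:S^*\to D^*$, where $(\mu,\eta)(\mu',\eta')=(\mu'',\eta'')$ with $\mu''_e=\mu_e\circ\mu'_e$ and $\eta''(s)=\mu_e(\eta'(s))\,\eta(s)$ for $s=e\cdot s$. It acts on 2-cocycles: $(\mu,\eta)*(\alpha,\xi)=(\beta,\zeta)$ means $$\mu_e\circ\beta_s\circ\mu_f^{-1}=\rho_{\eta(s)}\circ\alpha_s,\qquad \mu_e(\zeta(s,t))=\eta(s)\,\alpha_s(\eta(t))\,\xi(s,t)\,\eta(s\cdot t)^{-1}$$ for all $s=e\cdot s\cdot f$ and $t$ in $S^*$ (with $s\cdot t\neq\theta$ in the second equation). Write $[\alpha,\xi]$ for the orbit of $(\alpha,\xi)$. For $\phi\in\mathrm{Aut}\,S$ let $\alpha^\phi_s=\alpha_{\phi(s)}$ and $\xi^\phi(s,t)=\xi(\phi(s),\phi(t))$, and put $$\mathrm{Stab}_{[\alpha,\xi]}(\mathrm{Aut}\,S)=\{\phi\in\mathrm{Aut}\,S:[\alpha,\xi]=[\alpha^\phi,\xi^\phi]\}.$$ Let $Z^1_{(\alpha,\xi)}(S,D^*)\le G$ be the stabilizer of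 $(\alpha,\xi)$, let $B^1_{(\alpha,\xi)}(S,D^*)$ be its normal subgroup of all pairs $\bigl(e\mapsto\rho_{\epsilon(e)},\ s=e\cdot s\cdot f\mapsto\epsilon(e)\,\alpha_s(\epsilon(f)^{-1})\bigr)$ with $\epsilon:E\to D^*$, and let $H^1_{(\alpha,\xi)}(S,D^*)=Z^1_{(\alpha,\xi)}(S,D^*)/B^1_{(\alpha,\xi)}(S,D^*)$. \textbf{Rings.} $D^\alpha_\xi S$ is the left $D$-vector space with basis $S^*$ and the multiplication determined by $(ds)(d't)=d\,\alpha_s(d')\,\xi(s,t)\,(s\cdot t)$ if $s\cdot t\neq\theta$ and $(ds)(d't)=0$ otherwise; it is a ring with identity $\sum_{e\in E}\xi(e,e)^{-1}e$. A ring $R$ with identity is called square-free if it is basic, indecomposable and (left and right) artinian, and if in every indecomposable direct summand of ${}_RR$ and of $R_R$ each simple module occurs at most once as a composition factor. Here basic means that if $1=e_1+\dots+e_n$ with orthogonal primitive idempotents $e_i$, then the modules $Re_i$ are pairwise nonisomorphic. Let $\mathrm{Out}\,R=\mathrm{Aut}\,R/\mathrm{Inn}\,R$, where $\mathrm{Aut}\,R$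 is the group of ring automorphisms of $R$ and $\mathrm{Inn}\,R$ its subgroup of the maps $x\mapsto rxr^{-1}$, $r$ a unit of $R$. \textbf{Statement.} Let $S$ be a square-free semigroup, $D$ a division ring and $(\alpha,\xi)$ a 2-cocycle, and let $R\cong D^\alpha_\xi S$ be a square-free ring. If $H^1_{(\alpha,\xi)}(S,D^*)=1$, then $$\mathrm{Out}\,R\cong\mathrm{Stab}_{[\alpha,\xi]}(\mathrm{Aut}\,S)$$ as groups. If moreover $[\alpha,\xi]=[1_D,1]$, the class of the 2-cocycle with $\alpha_s=1_D$ for all $s$ and $\xi\equiv1$, then $\mathrm{Out}\,R\cong\mathrm{Aut}\,S$. -/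

import Mathlib

/-! ## Square-free semigroups -/

/-- A square-free semigroup: a semigroup with zero and a finite set `E` of pairwise orthogonal
(nonzero) idempotents such that `S = ⋃ e S f` and each `e S f` has at most one nonzero element. -/
class SquareFreeSemigroup (S : Type*) extends SemigroupWithZero S where
  E : Set S
  finite_E : E.Finite
  ne_zero_of_mem : ∀ e ∈ E, e ≠ 0
  idem : ∀ e ∈ E, e * e = e
  orth : ∀ e ∈ E, ∀ f ∈ E, e ≠ f → e * f = 0
  cover : ∀ s : S, ∃ e ∈ E, ∃ f ∈ E, ∃ x : S, s = e * x * f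
  unique : ∀ e ∈ E, ∀ f ∈ E, ∀ x y : S, e * x * f ≠ 0 → e * y * f ≠ 0 → e * x * f = e * y * f

namespace SquareFreeSemigroup

/-- The index set of `F⁰`: the idempotents in `E`. -/
abbrev Idem (S : Type*) [SquareFreeSemigroup S] : Type _ := {e : S // e ∈ E (S := S)}

/-- The nonzero elements of `S` (the index set of `F¹`). -/
abbrev Nz (S : Type*) [SquareFreeSemigroup S] : Type _ := {s : S // s ≠ 0}

/-- The pairs with nonzero product (the index set of `F²`). -/
abbrev Nz2 (S : Type*) [SquareFreeSemigroup S] : Type _ := {p : S × S // p.1 * p.2 ≠ 0}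

variable {S : Type*} [SquareFreeSemigroup S]

theorem exists_left_right (s : Nz S) :
    ∃ p : Idem S × Idem S, (p.1 : S) * s = s ∧ (s : S) * p.2 = s := by
  obtain ⟨e, he, f, hf, x, hx⟩ := cover s.1
  refine ⟨(⟨e, he⟩, ⟨f, hf⟩), ?_, ?_⟩
  · show e * s.1 = s.1
    rw [hx, ← mul_assoc, ← mul_assoc, idem e he]
  · show s.1 * f = s.1
    rw [hx, mul_assoc, idem f hf]

/-- The idempotent `e ∈ E` with `s = e · s`. -/
noncomputable def lft (s : Nz S) : Idem S := (exists_left_right s).choose.1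

/-- The idempotent `f ∈ E` with `s = s · f`. -/
noncomputable def rgt (s : Nz S) : Idem S := (exists_left_right s).choose.2

theorem lft_mul (s : Nz S) : (lft s : S) * s = s := (exists_left_right s).choose_spec.1

theorem mul_rgt (s : Nz S) : (s : S) * rgt s = s := (exists_left_right s).choose_spec.2

theorem lft_eq {s : Nz S} {e : Idem S} (h : (e : S) * s ≠ 0) : lft s = e := by
  by_contra hne
  apply h
  rw [← lft_mul s, ← mul_assoc, orth e.1 e.2 _ (lft s).2 (fun h' => hne (Subtype.ext h'.symm)),
    zero_mul]

theorem rgt_eq {s : Nz S} {f : Idem S} (h : (s : S) * f ≠ 0) : rgt s = f := by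
  by_contra hne
  apply h
  rw [← mul_rgt s, mul_assoc, orth _ (rgt s).2 f.1 f.2 (fun h' => hne (Subtype.ext h')),
    mul_zero]

theorem eq_of_lft_rgt {s t : Nz S} (h1 : lft s = lft t) (h2 : rgt s = rgt t) : s = t := by
  have hs : (lft s : S) * s.1 * rgt s = s.1 := by rw [lft_mul, mul_rgt]
  have ht : (lft s : S) * t.1 * rgt s = t.1 := by rw [h1, h2, lft_mul, mul_rgt]
  have := unique (lft s).1 (lft s).2 (rgt s).1 (rgt s).2 s.1 t.1 (by rw [hs]; exact s.2)
    (by rw [ht]; exact t.2)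
  exact Subtype.ext (by rw [← hs, this, ht])

instance : Finite (Idem S) := (finite_E (S := S)).to_subtype

instance : Finite (Nz S) :=
  Finite.of_injective (fun s : Nz S => (lft s, rgt s)) (by
    intro s t h
    exact eq_of_lft_rgt (Prod.ext_iff.1 h).1 (Prod.ext_iff.1 h).2)

theorem ne_zero_left {s t : S} (h : s * t ≠ 0) : s ≠ 0 := fun h' => h (by rw [h', zero_mul])

theorem ne_zero_right {s t : S} (h : s * t ≠ 0) : t ≠ 0 := fun h' => h (by rw [h', mul_zero])

theorem ne_zero_mid {s t u : S} (h : s * t * u ≠ 0) : t * u ≠ 0 := by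
  rw [mul_assoc] at h; exact ne_zero_right h

/-- The components `s`, `t` and the product `s · t` of a pair with nonzero product. -/
def Nz2.fst (p : Nz2 S) : Nz S := ⟨p.1.1, ne_zero_left p.2⟩


def Nz2.snd (p : Nz2 S) : Nz S := ⟨p.1.2, ne_zero_right p.2⟩


def Nz2.prod (p : Nz2 S) : Nz S := ⟨p.1.1 * p.1.2, p.2⟩

instance : Finite (Nz2 S) :=
  Finite.of_injective (fun p : Nz2 S => (Nz2.fst p, Nz2.snd p)) (by
    intro p q h
    have h1 := congrArg Subtype.val (Prod.ext_iff.1 h).1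
    have h2 := congrArg Subtype.val (Prod.ext_iff.1 h).2
    exact Subtype.ext (Prod.ext h1 h2))

noncomputable instance : Fintype (Nz2 S) := Fintype.ofFinite _

theorem lft_prod (p : Nz2 S) : lft (Nz2.prod p) = lft (Nz2.fst p) := by
  apply lft_eq
  have h : (lft (Nz2.fst p) : S) * p.1.1 = p.1.1 := lft_mul (Nz2.fst p)
  show (lft (Nz2.fst p) : S) * (p.1.1 * p.1.2) ≠ 0
  rw [← mul_assoc, h]; exact p.2

theorem rgt_prod (p : Nz2 S) : rgt (Nz2.prod p) = rgt (Nz2.snd p) := by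
  apply rgt_eq
  have h : p.1.2 * (rgt (Nz2.snd p) : S) = p.1.2 := mul_rgt (Nz2.snd p)
  show p.1.1 * p.1.2 * (rgt (Nz2.snd p) : S) ≠ 0
  rw [mul_assoc, h]; exact p.2

theorem lft_snd (p : Nz2 S) : lft (Nz2.snd p) = rgt (Nz2.fst p) := by
  apply lft_eq
  have h : p.1.1 * (rgt (Nz2.fst p) : S) = p.1.1 := mul_rgt (Nz2.fst p)
  have h2 : p.1.1 * ((rgt (Nz2.fst p) : S) * p.1.2) ≠ 0 := by
    rw [← mul_assoc, h]; exact p.2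
  exact ne_zero_right h2

/-- `E` is exactly the set of nonzero idempotents of `S`. -/
theorem mem_E_iff {s : S} : s ∈ E (S := S) ↔ s ≠ 0 ∧ s * s = s := by
  refine ⟨fun h => ⟨ne_zero_of_mem s h, idem s h⟩, fun ⟨h0, h1⟩ => ?_⟩
  let p : Nz2 S := ⟨(s, s), by rw [h1]; exact h0⟩
  have hlr : lft (⟨s, h0⟩ : Nz S) = rgt (⟨s, h0⟩ : Nz S) := lft_snd p
  set e := lft (⟨s, h0⟩ : Nz S) with he
  have hl : (e : S) * s = s := lft_mul (⟨s, h0⟩ : Nz S)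
  have hr : s * (e : S) = s := by rw [hlr]; exact mul_rgt (⟨s, h0⟩ : Nz S)
  have hee : (e : S) * e * e = e := by rw [idem _ e.2, idem _ e.2]
  have := unique e.1 e.2 e.1 e.2 s e (by rw [hl, hr]; exact h0)
    (by rw [hee]; exact ne_zero_of_mem _ e.2)
  rw [hl, hr, hee] at this
  rw [this]; exact e.2

/-! The action of a semigroup automorphism on `E`, on `S \ {0}` and on composable pairs. -/

theorem aut_zero (φ : MulAut S) : φ 0 = 0 := by
  have h : φ (0 * φ.symm 0) = φ 0 * φ (φ.symm 0) := map_mul φ _ _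
  rwa [zero_mul, MulEquiv.apply_symm_apply, mul_zero] at h

theorem aut_ne_zero (φ : MulAut S) {s : S} (h : s ≠ 0) : φ s ≠ 0 :=
  fun h' => h (φ.injective (by rw [h', aut_zero]))

theorem aut_mem (φ : MulAut S) {e : S} (h : e ∈ E (S := S)) : φ e ∈ E (S := S) := by
  rw [mem_E_iff] at h ⊢
  exact ⟨aut_ne_zero φ h.1, by rw [← map_mul, h.2]⟩

def autIdem (φ : MulAut S) (e : Idem S) : Idem S := ⟨φ e, aut_mem φ e.2⟩

def autNz (φ : MulAut S) (s : Nz S) : Nz S := ⟨φ s, aut_ne_zero φ s.2⟩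

def autNz2 (φ : MulAut S) (p : Nz2 S) : Nz2 S :=
  ⟨(φ p.1.1, φ p.1.2), by
    show φ p.1.1 * φ p.1.2 ≠ 0
    rw [← map_mul]; exact aut_ne_zero φ p.2⟩

theorem autNz2_prod (φ : MulAut S) (p : Nz2 S) :
    Nz2.prod (autNz2 φ p) = autNz φ (Nz2.prod p) :=
  Subtype.ext (map_mul φ p.1.1 p.1.2).symm

theorem autIdem_lft (φ : MulAut S) (s : Nz S) : lft (autNz φ s) = autIdem φ (lft s) := by
  apply lft_eq
  show φ (lft s : S) * φ s ≠ 0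
  rw [← map_mul, lft_mul]; exact aut_ne_zero φ s.2

theorem autIdem_rgt (φ : MulAut S) (s : Nz S) : rgt (autNz φ s) = autIdem φ (rgt s) := by
  apply rgt_eq
  show φ s * φ (rgt s : S) ≠ 0
  rw [← map_mul, mul_rgt]; exact aut_ne_zero φ s.2

end SquareFreeSemigroup

open SquareFreeSemigroup

/-! ## Nonabelian cohomology of a square-free semigroup with coefficients in `D*` -/

/-- 2-cochains `(α, ξ) ∈ F¹(S, Aut D) × F²(S, D*)`. -/
@[ext]
structure TwoCochain (S D : Type*) [SquareFreeSemigroup S] [DivisionRing D] where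
  α : Nz S → RingAut D
  ξ : Nz2 S → Dˣ

/-- The 2-cocycle conditions
`α_s (ξ(t,u)) ξ(s, t·u) = ξ(s,t) ξ(s·t, u)` whenever `s·t·u ≠ 0`, and
`α_s ∘ α_t = ρ_{ξ(s,t)} ∘ α_{s·t}` whenever `s·t ≠ 0`, where `ρ_d x = d x d⁻¹`. -/
structure TwoCochain.IsCocycle {S D : Type*} [SquareFreeSemigroup S] [DivisionRing D]
    (c : TwoCochain S D) : Prop where
  assoc : ∀ (s t u : S) (h : s * t * u ≠ 0),
    c.α ⟨s, ne_zero_left (ne_zero_left h)⟩ (c.ξ ⟨(t, u), ne_zero_mid h⟩)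
        * (c.ξ ⟨(s, t * u), by rw [← mul_assoc]; exact h⟩ : D)
      = c.ξ ⟨(s, t), ne_zero_left h⟩ * c.ξ ⟨(s * t, u), h⟩
  twist : ∀ (p : Nz2 S) (x : D),
    c.α (Nz2.fst p) (c.α (Nz2.snd p) x) = c.ξ p * c.α (Nz2.prod p) x * ((c.ξ p)⁻¹ : Dˣ)

/-- The set `Z²(S, D*)` of 2-cocycles. -/
abbrev TwoCocycle (S D : Type*) [SquareFreeSemigroup S] [DivisionRing D] : Type _ :=
  {c : TwoCochain S D // c.IsCocycle}

/-- Elements `(μ, η)` of the group `F⁰(S, Aut D) ⋉ F¹(S, D*)`. -/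
@[ext]
structure OneCochain (S D : Type*) [SquareFreeSemigroup S] [DivisionRing D] where
  μ : Idem S → RingAut D
  η : Nz S → Dˣ

namespace OneCochain

variable {S D : Type*} [SquareFreeSemigroup S] [DivisionRing D]

/-- The product `(μ, η)(μ', η') = (μ ∘ μ', s = e·s ↦ μ_e(η'(s)) η(s))`; it corresponds to the
composition of the maps `d s ↦ μ_e(d) η(s) s`. -/
noncomputable instance : Mul (OneCochain S D) where
  mul g h := ⟨fun e => g.μ e * h.μ e,
    fun s => Units.map (g.μ (lft s) : D →* D) (h.η s) * g.η s⟩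

instance : One (OneCochain S D) where
  one := ⟨fun _ => 1, fun _ => 1⟩

noncomputable instance : Inv (OneCochain S D) where
  inv g := ⟨fun e => (g.μ e)⁻¹,
    fun s => Units.map (((g.μ (lft s))⁻¹ : RingAut D) : D →* D) (g.η s)⁻¹⟩

@[simp] theorem mul_μ (g h : OneCochain S D) (e : Idem S) : (g * h).μ e = g.μ e * h.μ e := rfl

@[simp] theorem mul_η (g h : OneCochain S D) (s : Nz S) :
    (g * h).η s = Units.map (g.μ (lft s) : D →* D) (h.η s) * g.η s := rfl

@[simp] theorem one_μ (e : Idem S) : (1 : OneCochain S D).μ e = 1 := rfl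

@[simp] theorem one_η (s : Nz S) : (1 : OneCochain S D).η s = 1 := rfl

@[simp] theorem inv_μ (g : OneCochain S D) (e : Idem S) : (g⁻¹).μ e = (g.μ e)⁻¹ := rfl

@[simp] theorem inv_η (g : OneCochain S D) (s : Nz S) :
    (g⁻¹).η s = Units.map (((g.μ (lft s))⁻¹ : RingAut D) : D →* D) (g.η s)⁻¹ := rfl

noncomputable instance : Group (OneCochain S D) :=
  Group.ofLeftAxioms
    (by
      intro a b c
      ext s <;> simp [mul_assoc])
    (by
      intro a
      ext s <;> simp)
    (by
      intro a
      ext s <;> simp)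

/-- `g.Transforms c c'` says `g * c = c'` for the action of `F⁰(S, Aut D) ⋉ F¹(S, D*)` on
2-cochains: with `g = (μ, η)`, `c = (α, ξ)`, `c' = (β, ζ)`,
`μ_e ∘ β_s ∘ μ_f⁻¹ = ρ_{η(s)} ∘ α_s` for `s = e·s·f`, and
`μ_e(ζ(s,t)) = η(s) α_s(η(t)) ξ(s,t) η(s·t)⁻¹` for `s = e·s`, `s·t ≠ 0`. -/
structure Transforms (g : OneCochain S D) (c c' : TwoCochain S D) : Prop where
  aut : ∀ (s : Nz S) (x : D),
    g.μ (lft s) (c'.α s ((g.μ (rgt s)).symm x)) = g.η s * c.α s x * ((g.η s)⁻¹ : Dˣ)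
  unit : ∀ p : Nz2 S,
    g.μ (lft (Nz2.fst p)) (c'.ξ p : D)
      = g.η (Nz2.fst p) * c.α (Nz2.fst p) (g.η (Nz2.snd p)) * c.ξ p
          * ((g.η (Nz2.prod p))⁻¹ : Dˣ)

theorem Transforms.aut' {g : OneCochain S D} {c c' : TwoCochain S D} (h : g.Transforms c c')
    (s : Nz S) (x : D) :
    g.μ (lft s) (c'.α s x) = g.η s * c.α s (g.μ (rgt s) x) * ((g.η s)⁻¹ : Dˣ) := by
  rw [← h.aut, RingEquiv.symm_apply_apply]

theorem Transforms.one (c : TwoCochain S D) : (1 : OneCochain S D).Transforms c c where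
  aut s x := by
    have : ((1 : RingAut D)).symm x = x := rfl
    simp [this]
  unit p := by simp

theorem Transforms.mul {g h : OneCochain S D} {a b c : TwoCochain S D}
    (hg : g.Transforms a b) (hh : h.Transforms b c) : (g * h).Transforms a c where
  aut s x := by
    have e1 : ((g * h).μ (rgt s)).symm x = (h.μ (rgt s)).symm ((g.μ (rgt s)).symm x) := rfl
    rw [e1]
    simp only [mul_μ, mul_η, RingAut.mul_apply]
    rw [hh.aut]
    simp only [map_mul, hg.aut', RingEquiv.apply_symm_apply]
    simp [mul_assoc]
  unit p := by
    simp only [mul_μ, mul_η, RingAut.mul_apply]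
    rw [hh.unit]
    simp only [map_mul, hg.unit, hg.aut', lft_prod, lft_snd]
    simp [mul_assoc]

theorem Transforms.inv {g : OneCochain S D} {a b : TwoCochain S D}
    (hg : g.Transforms a b) : (g⁻¹).Transforms b a where
  aut s x := by
    apply (g.μ (lft s)).injective
    have e1 : ((g⁻¹).μ (rgt s)).symm x = g.μ (rgt s) x := rfl
    rw [e1]
    simp [hg.aut', mul_assoc]
  unit p := by
    apply (g.μ (lft (Nz2.fst p))).injective
    simp [hg.aut', hg.unit, lft_prod, lft_snd, mul_assoc]

end OneCochain

section Cohomology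

variable {S D : Type*} [SquareFreeSemigroup S] [DivisionRing D]

/-- `[α, ξ] = [β, ζ]`: the two cocycles lie in one orbit. -/
def Cohomologous (c c' : TwoCocycle S D) : Prop :=
  ∃ g : OneCochain S D, g.Transforms c.1 c'.1

instance cohomologousSetoid (S D : Type*) [SquareFreeSemigroup S] [DivisionRing D] :
    Setoid (TwoCocycle S D) where
  r := Cohomologous
  iseqv :=
    { refl := fun c => ⟨1, .one c.1⟩
      symm := fun ⟨g, h⟩ => ⟨g⁻¹, h.inv⟩
      trans := fun ⟨g, h⟩ ⟨g', h'⟩ => ⟨g * g', h.mul h'⟩ }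

/-- The thin second cohomology `H²(S, D*)`, the set of orbits in `Z²(S, D*)`. -/
abbrev H2 (S D : Type*) [SquareFreeSemigroup S] [DivisionRing D] : Type _ :=
  Quotient (cohomologousSetoid S D)

/-- The class `[α, ξ]`. -/
def TwoCocycle.cls (c : TwoCocycle S D) : H2 S D := Quotient.mk _ c

/-- The trivial cocycle `(1_D, 1)`. -/
def TwoCocycle.triv (S D : Type*) [SquareFreeSemigroup S] [DivisionRing D] : TwoCocycle S D :=
  ⟨⟨fun _ => 1, fun _ => 1⟩, ⟨by intros; simp, by intros; simp⟩⟩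

/-- `(α^φ, ξ^φ)`, where `α^φ(s) = α(φ(s))` and `ξ^φ(s,t) = ξ(φ(s), φ(t))`. -/
def TwoCocycle.pull (φ : MulAut S) (c : TwoCocycle S D) : TwoCocycle S D :=
  ⟨⟨fun s => c.1.α (autNz φ s), fun p => c.1.ξ (autNz2 φ p)⟩,
    { assoc := fun s t u h => by
        have := c.2.assoc (φ s) (φ t) (φ u)
          (by rw [← map_mul, ← map_mul]; exact aut_ne_zero φ h)
        simpa only [autNz, autNz2, map_mul] using this
      twist := fun p x => by
        have := c.2.twist (autNz2 φ p) x
        rw [autNz2_prod] at this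
        exact this }⟩

theorem TwoCocycle.pull_one (c : TwoCocycle S D) : TwoCocycle.pull 1 c = c := rfl

theorem TwoCocycle.pull_mul (φ ψ : MulAut S) (c : TwoCocycle S D) :
    TwoCocycle.pull (φ * ψ) c = TwoCocycle.pull ψ (TwoCocycle.pull φ c) := rfl

theorem Cohomologous.pull (φ : MulAut S) {c c' : TwoCocycle S D} (h : Cohomologous c c') :
    Cohomologous (TwoCocycle.pull φ c) (TwoCocycle.pull φ c') := by
  obtain ⟨g, hg⟩ := h
  refine ⟨⟨fun e => g.μ (autIdem φ e), fun s => g.η (autNz φ s)⟩, ⟨fun s x => ?_, fun p => ?_⟩⟩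
  · have := hg.aut (autNz φ s) x
    rw [autIdem_lft, autIdem_rgt] at this
    exact this
  · have := hg.unit (autNz2 φ p)
    rw [autNz2_prod] at this
    have e : lft (Nz2.fst (autNz2 φ p)) = autIdem φ (lft (Nz2.fst p)) :=
      autIdem_lft φ (Nz2.fst p)
    rw [e] at this
    exact this

/-- The stabilizer `{φ ∈ Aut S | [α, ξ] = [α^φ, ξ^φ]}` of `[α, ξ]` in `Aut S`. -/
def stabAut (c : TwoCocycle S D) : Subgroup (MulAut S) where
  carrier := {φ | c.cls = (TwoCocycle.pull φ c).cls}
  one_mem' := rfl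
  mul_mem' := by
    intro φ ψ hφ hψ
    have h1 : Cohomologous c (TwoCocycle.pull φ c) := Quotient.exact hφ
    have h2 : Cohomologous c (TwoCocycle.pull ψ c) := Quotient.exact hψ
    exact Quotient.sound ((cohomologousSetoid S D).trans h2 (h1.pull ψ))
  inv_mem' := by
    intro φ hφ
    have h1 : Cohomologous c (TwoCocycle.pull φ c) := Quotient.exact hφ
    have h2 := h1.pull φ⁻¹
    rw [← TwoCocycle.pull_mul, mul_inv_cancel, TwoCocycle.pull_one] at h2
    exact Quotient.sound ((cohomologousSetoid S D).symm h2)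

/-- The group `Z¹_{(α,ξ)}(S, D*)` of `(α, ξ)` 1-cocycles, the stabilizer of `(α, ξ)` in
`F⁰(S, Aut D) ⋉ F¹(S, D*)`. -/
def Z1 (c : TwoCocycle S D) : Subgroup (OneCochain S D) where
  carrier := {g | g.Transforms c.1 c.1}
  one_mem' := .one c.1
  mul_mem' := fun hg hh => hg.mul hh
  inv_mem' := fun hg => hg.inv

/-- The 1-coboundary of `ε ∈ F⁰(S, D*)`: the pair `(μ, η)` with `μ_e = ρ_{ε(e)}` and
`η(s) = ε(e) α_s(ε(f)⁻¹)` for `s = e·s·f`. -/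
noncomputable def coboundary (c : TwoCocycle S D) (ε : Idem S → Dˣ) : OneCochain S D where
  μ e := MulSemiringAction.toRingAut (ConjAct Dˣ) D (ConjAct.toConjAct (ε e))
  η s := ε (lft s) * Units.map (c.1.α s : D →* D) (ε (rgt s))⁻¹

theorem coboundary_μ_apply (c : TwoCocycle S D) (ε : Idem S → Dˣ) (e : Idem S) (x : D) :
    (coboundary c ε).μ e x = ε e * x * ((ε e)⁻¹ : Dˣ) := rfl

theorem coboundary_one (c : TwoCocycle S D) : coboundary c 1 = 1 := by
  ext s
  · simp [coboundary_μ_apply]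
  · simp [coboundary]

theorem coboundary_mul (c : TwoCocycle S D) (ε δ : Idem S → Dˣ) :
    coboundary c (ε * δ) = coboundary c ε * coboundary c δ := by
  ext s x
  · simp [coboundary_μ_apply, mul_assoc]
  · simp only [OneCochain.mul_η, Units.val_mul, Units.coe_map, MonoidHom.coe_coe]
    rw [show ((coboundary c ε).μ (lft s)) ((coboundary c δ).η s)
      = _ from coboundary_μ_apply c ε _ _]
    simp [coboundary, mul_assoc]

theorem coboundary_mem (c : TwoCocycle S D) (ε : Idem S → Dˣ) : coboundary c ε ∈ Z1 c := by
  constructor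
  · intro s x
    have e1 : ((coboundary c ε).μ (rgt s)).symm x
        = ((ε (rgt s))⁻¹ : Dˣ) * x * (ε (rgt s) : D) := by
      rw [RingEquiv.symm_apply_eq, coboundary_μ_apply]
      simp [mul_assoc]
    rw [e1, coboundary_μ_apply]
    simp [coboundary, mul_assoc]
  · intro p
    have h := c.2.twist p (((ε (rgt (Nz2.snd p)))⁻¹ : Dˣ) : D)
    rw [coboundary_μ_apply]
    simp only [coboundary, Units.val_mul, Units.coe_map, MonoidHom.coe_coe, map_mul, h,
      lft_prod, rgt_prod, lft_snd, mul_inv_rev]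
    simp [mul_assoc, ← map_inv]

/-- The subgroup `B¹_{(α,ξ)}(S, D*)` of 1-coboundaries. -/
def B1 (c : TwoCocycle S D) : Subgroup (Z1 c) where
  carrier := {g | ∃ ε : Idem S → Dˣ, (g : OneCochain S D) = coboundary c ε}
  one_mem' := ⟨1, (coboundary_one c).symm⟩
  mul_mem' := by
    rintro g h ⟨ε, hε⟩ ⟨δ, hδ⟩
    exact ⟨ε * δ, by rw [Subgroup.coe_mul, hε, hδ, coboundary_mul]⟩
  inv_mem' := by
    rintro g ⟨ε, hε⟩
    refine ⟨ε⁻¹, ?_⟩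
    rw [Subgroup.coe_inv, hε, inv_eq_iff_mul_eq_one, ← coboundary_mul, mul_inv_cancel,
      coboundary_one]

instance (c : TwoCocycle S D) : (B1 c).Normal where
  conj_mem := by
    rintro b ⟨ε, hε⟩ g
    refine ⟨fun e => Units.map ((g : OneCochain S D).μ e : D →* D) (ε e), ?_⟩
    rw [Subgroup.coe_mul, Subgroup.coe_mul, Subgroup.coe_inv, hε, mul_inv_eq_iff_eq_mul]
    have hg : (g : OneCochain S D).Transforms c.1 c.1 := g.2
    ext s x
    · simp [coboundary_μ_apply]
    · simp only [OneCochain.mul_η, Units.val_mul, Units.coe_map, MonoidHom.coe_coe]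
      rw [show ∀ (δ : Idem S → Dˣ) (y : D), ((coboundary c δ).μ (lft s)) y
        = _ from fun δ y => coboundary_μ_apply c δ _ y]
      simp only [coboundary, Units.val_mul, Units.coe_map, MonoidHom.coe_coe, map_mul, hg.aut']
      simp [mul_assoc]

/-- The first cohomology group `H¹_{(α,ξ)}(S, D*) = Z¹/B¹`. -/
abbrev H1 (c : TwoCocycle S D) : Type _ := Z1 c ⧸ B1 c

end Cohomology

/-! ## The ring `D^α_ξ S` -/

/-- The left `D`-vector space on `S* = S \ {0}`; `x s` is the coefficient of `s` in `x`. -/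
def TwistedRing {S D : Type*} [SquareFreeSemigroup S] [DivisionRing D] (_c : TwoCocycle S D) :
    Type _ := Nz S → D

namespace TwistedRing

variable {S D : Type*} [SquareFreeSemigroup S] [DivisionRing D] {c : TwoCocycle S D}

@[ext] theorem ext {x y : TwistedRing c} (h : ∀ s : Nz S, x s = y s) : x = y := funext h

instance : AddCommGroup (TwistedRing c) := inferInstanceAs (AddCommGroup (Nz S → D))

theorem add_apply (x y : TwistedRing c) (s : Nz S) : (x + y) s = x s + y s := rfl

theorem zero_apply (s : Nz S) : (0 : TwistedRing c) s = 0 := rfl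

open scoped Classical in
/-- The multiplication determined by `(d s)(d' t) = d α_s(d') ξ(s,t) (s·t)` if `s·t ≠ 0` and
`(d s)(d' t) = 0` otherwise. -/
noncomputable instance : Mul (TwistedRing c) where
  mul x y u := ∑ p : Nz2 S with Nz2.prod p = u,
    x (Nz2.fst p) * c.1.α (Nz2.fst p) (y (Nz2.snd p)) * c.1.ξ p

open scoped Classical in
theorem mul_apply (x y : TwistedRing c) (u : Nz S) :
    (x * y) u = ∑ p : Nz2 S with Nz2.prod p = u,
      x (Nz2.fst p) * c.1.α (Nz2.fst p) (y (Nz2.snd p)) * c.1.ξ p := rfl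

/-- An idempotent in `E` as a nonzero element of `S`. -/
def idemNz (e : Idem S) : Nz S := ⟨e, ne_zero_of_mem _ e.2⟩

/-- The pair `(e, e)` for `e ∈ E`. -/
def idemPair (e : Idem S) : Nz2 S :=
  ⟨(e, e), by
    show (e : S) * e ≠ 0
    rw [idem _ e.2]; exact ne_zero_of_mem _ e.2⟩

open scoped Classical in
/-- The identity `∑_{e ∈ E} ξ(e,e)⁻¹ e`. -/
noncomputable instance : One (TwistedRing c) where
  one u := if h : (u : S) ∈ E (S := S) then (((c.1.ξ (idemPair ⟨u, h⟩))⁻¹ : Dˣ) : D) else 0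

theorem one_apply_idem (e : Idem S) :
    (1 : TwistedRing c) (idemNz e) = ((c.1.ξ (idemPair e))⁻¹ : Dˣ) :=
  dif_pos e.2

theorem one_apply_of_notMem {u : Nz S} (h : (u : S) ∉ E (S := S)) :
    (1 : TwistedRing c) u = 0 :=
  dif_neg h

theorem α_idem (c : TwoCocycle S D) (e : Idem S) (x : D) :
    c.1.α (idemNz e) x = c.1.ξ (idemPair e) * x * ((c.1.ξ (idemPair e))⁻¹ : Dˣ) := by
  obtain ⟨y, rfl⟩ := (c.1.α (idemNz e)).surjective x
  have h := c.2.twist (idemPair e) y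
  have h1 : Nz2.prod (idemPair e) = idemNz e := Subtype.ext (idem _ e.2)
  rw [h1] at h
  exact h

theorem ξ_left (c : TwoCocycle S D) (p : Nz2 S) (e : Idem S) (h : Nz2.fst p = idemNz e) :
    (c.1.ξ p : D) = c.1.ξ (idemPair e) := by
  obtain ⟨⟨a, s⟩, hp⟩ := p
  have ha : a = e := congrArg Subtype.val h
  subst ha
  have hes : (e : S) * s = s := by
    have := lft_eq (s := ⟨s, ne_zero_right hp⟩) (e := e) hp
    have h2 := lft_mul (⟨s, ne_zero_right hp⟩ : Nz S)
    rwa [this] at h2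
  have h3 := c.2.assoc e e s (by rw [idem _ e.2]; exact hp)
  simp only [hes, idem _ e.2] at h3
  have h4 := mul_right_cancel₀ (c.1.ξ ⟨((e : S), s), hp⟩).ne_zero h3
  have h5 := α_idem c e (c.1.ξ ⟨((e : S), s), hp⟩)
  have h6 : c.1.α (idemNz e) (c.1.ξ ⟨((e : S), s), hp⟩) = c.1.ξ (idemPair e) := h4
  rw [h6, mul_assoc] at h5
  have h7 : (1 : D) = c.1.ξ ⟨((e : S), s), hp⟩ * ((c.1.ξ (idemPair e))⁻¹ : Dˣ) := by
    apply mul_left_cancel₀ (c.1.ξ (idemPair e)).ne_zero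
    rw [mul_one]; exact h5
  rw [Units.eq_mul_inv_iff_mul_eq, one_mul] at h7
  exact h7.symm

theorem ξ_right (c : TwoCocycle S D) (p : Nz2 S) (f : Idem S) (h : Nz2.snd p = idemNz f) :
    (c.1.ξ p : D) = c.1.α (Nz2.fst p) (c.1.ξ (idemPair f)) := by
  obtain ⟨⟨s, a⟩, hp⟩ := p
  have ha : a = f := congrArg Subtype.val h
  subst ha
  have hsf : s * (f : S) = s := by
    have := rgt_eq (s := ⟨s, ne_zero_left hp⟩) (f := f) hp
    have h2 := mul_rgt (⟨s, ne_zero_left hp⟩ : Nz S)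
    rwa [this] at h2
  have h3 := c.2.assoc s f f (by rw [hsf]; exact hp)
  simp only [hsf, idem _ f.2] at h3
  exact (mul_right_cancel₀ (c.1.ξ ⟨(s, (f : S)), hp⟩).ne_zero h3).symm

/-- The pair `(e, s)` for `s = e · s`. -/
noncomputable def leftPair (s : Nz S) : Nz2 S :=
  ⟨(lft s, s), by
    show (lft s : S) * s ≠ 0
    rw [lft_mul]; exact s.2⟩

/-- The pair `(s, f)` for `s = s · f`. -/
noncomputable def rightPair (s : Nz S) : Nz2 S :=
  ⟨(s, rgt s), by
    show (s : S) * rgt s ≠ 0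
    rw [mul_rgt]; exact s.2⟩

theorem eq_leftPair {p : Nz2 S} (h : (p.1.1 : S) ∈ E (S := S)) :
    p = leftPair (Nz2.prod p) := by
  obtain ⟨⟨a, s⟩, hp⟩ := p
  have hl : lft (⟨s, ne_zero_right hp⟩ : Nz S) = ⟨a, h⟩ := lft_eq (e := ⟨a, h⟩) hp
  have h1 : a * s = s := by
    have h2 := lft_mul (⟨s, ne_zero_right hp⟩ : Nz S)
    rwa [hl] at h2
  have h3 : Nz2.prod ⟨(a, s), hp⟩ = (⟨s, ne_zero_right hp⟩ : Nz S) := Subtype.ext h1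
  rw [h3]
  exact Subtype.ext (Prod.ext (by simp [leftPair, hl]) rfl)

theorem eq_rightPair {p : Nz2 S} (h : (p.1.2 : S) ∈ E (S := S)) :
    p = rightPair (Nz2.prod p) := by
  obtain ⟨⟨s, a⟩, hp⟩ := p
  have hl : rgt (⟨s, ne_zero_left hp⟩ : Nz S) = ⟨a, h⟩ := rgt_eq (f := ⟨a, h⟩) hp
  have h1 : s * a = s := by
    have h2 := mul_rgt (⟨s, ne_zero_left hp⟩ : Nz S)
    rwa [hl] at h2
  have h3 : Nz2.prod ⟨(s, a), hp⟩ = (⟨s, ne_zero_left hp⟩ : Nz S) := Subtype.ext h1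
  rw [h3]
  exact Subtype.ext (Prod.ext rfl (by simp [rightPair, hl]))

protected theorem one_mul (x : TwistedRing c) : 1 * x = x := by
  classical
  ext u
  rw [mul_apply, Finset.sum_eq_single (leftPair u)]
  · have h1 : Nz2.fst (leftPair u) = idemNz (lft u) := rfl
    have h2 : Nz2.snd (leftPair u) = u := rfl
    rw [ξ_left c _ _ h1, h1, h2, one_apply_idem, α_idem]
    simp [mul_assoc]
  · intro p hp hne
    have hp' : Nz2.prod p = u := by simpa using hp
    rw [one_apply_of_notMem, zero_mul, zero_mul]
    intro hE
    exact hne (by rw [← hp']; exact eq_leftPair hE)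
  · intro h
    exact absurd (by simpa using Subtype.ext (lft_mul u)) h

protected theorem mul_one (x : TwistedRing c) : x * 1 = x := by
  classical
  ext u
  rw [mul_apply, Finset.sum_eq_single (rightPair u)]
  · have h1 : Nz2.snd (rightPair u) = idemNz (rgt u) := rfl
    have h2 : Nz2.fst (rightPair u) = u := rfl
    rw [ξ_right c _ _ h1, h1, h2, one_apply_idem, mul_assoc, ← map_mul]
    simp
  · intro p hp hne
    have hp' : Nz2.prod p = u := by simpa using hp
    rw [one_apply_of_notMem, map_zero, mul_zero, zero_mul]
    intro hE
    exact hne (by rw [← hp']; exact eq_rightPair hE)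
  · intro h
    exact absurd (by simpa using Subtype.ext (mul_rgt u)) h

theorem fst_prod_eq {p q : Nz2 S} (h : Nz2.prod q = Nz2.fst p) :
    q.1.1 * q.1.2 * p.1.2 ≠ 0 := by
  have : q.1.1 * q.1.2 = p.1.1 := congrArg Subtype.val h
  rw [this]; exact p.2

theorem snd_prod_eq {p q : Nz2 S} (h : Nz2.prod q = Nz2.snd p) :
    p.1.1 * q.1.1 * q.1.2 ≠ 0 := by
  have : q.1.1 * q.1.2 = p.1.2 := congrArg Subtype.val h
  rw [mul_assoc, this]; exact p.2

protected theorem mul_assoc (x y z : TwistedRing c) : x * y * z = x * (y * z) := by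
  classical
  ext u
  simp only [mul_apply, Finset.sum_mul, Finset.mul_sum, map_sum]
  rw [Finset.sum_sigma', Finset.sum_sigma']
  have hL : ∀ a ∈ (Finset.univ.filter fun p : Nz2 S => Nz2.prod p = u).sigma
      (fun p => Finset.univ.filter fun q : Nz2 S => Nz2.prod q = Nz2.fst p),
      Nz2.prod a.1 = u ∧ Nz2.prod a.2 = Nz2.fst a.1 := by
    intro a ha
    simpa using ha
  have hR : ∀ a ∈ (Finset.univ.filter fun p : Nz2 S => Nz2.prod p = u).sigma
      (fun p => Finset.univ.filter fun q : Nz2 S => Nz2.prod q = Nz2.snd p),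
      Nz2.prod a.1 = u ∧ Nz2.prod a.2 = Nz2.snd a.1 := by
    intro a ha
    simpa using ha
  refine Finset.sum_bij'
    (i := fun a ha => ⟨⟨(a.2.1.1, a.2.1.2 * a.1.1.2), by
        show a.2.1.1 * (a.2.1.2 * a.1.1.2) ≠ 0
        rw [← mul_assoc]; exact fst_prod_eq (hL a ha).2⟩,
      ⟨(a.2.1.2, a.1.1.2), ne_zero_mid (fst_prod_eq (hL a ha).2)⟩⟩)
    (j := fun b hb => ⟨⟨(b.1.1.1 * b.2.1.1, b.2.1.2), snd_prod_eq (hR b hb).2⟩,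
      ⟨(b.1.1.1, b.2.1.1), ne_zero_left (snd_prod_eq (hR b hb).2)⟩⟩)
    ?_ ?_ ?_ ?_ ?_
  · intro a ha
    have h1 : a.1.1.1 * a.1.1.2 = u := congrArg Subtype.val (hL a ha).1
    have h2 : a.2.1.1 * a.2.1.2 = a.1.1.1 := congrArg Subtype.val (hL a ha).2
    rw [Finset.mem_sigma, Finset.mem_filter, Finset.mem_filter]
    refine ⟨⟨Finset.mem_univ _, Subtype.ext ?_⟩, Finset.mem_univ _, rfl⟩
    show a.2.1.1 * (a.2.1.2 * a.1.1.2) = u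
    rw [← mul_assoc, h2, h1]
  · intro b hb
    have h1 : b.1.1.1 * b.1.1.2 = u := congrArg Subtype.val (hR b hb).1
    have h2 : b.2.1.1 * b.2.1.2 = b.1.1.2 := congrArg Subtype.val (hR b hb).2
    rw [Finset.mem_sigma, Finset.mem_filter, Finset.mem_filter]
    refine ⟨⟨Finset.mem_univ _, Subtype.ext ?_⟩, Finset.mem_univ _, rfl⟩
    show b.1.1.1 * b.2.1.1 * b.2.1.2 = u
    rw [mul_assoc, h2, h1]
  · rintro ⟨⟨⟨a1, a2⟩, ha1⟩, ⟨⟨b1, b2⟩, hb1⟩⟩ ha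
    have h2 : b1 * b2 = a1 := congrArg Subtype.val (hL _ ha).2
    subst h2
    rfl
  · rintro ⟨⟨⟨a1, a2⟩, ha1⟩, ⟨⟨b1, b2⟩, hb1⟩⟩ ha
    have h2 : b1 * b2 = a2 := congrArg Subtype.val (hR _ ha).2
    subst h2
    rfl
  · rintro ⟨⟨⟨a1, t⟩, ha1⟩, ⟨⟨r, s⟩, hb1⟩⟩ ha
    have h2 : r * s = a1 := congrArg Subtype.val (hL _ ha).2
    subst h2
    have h3 := c.2.assoc r s t ha1
    have h4 := c.2.twist ⟨(r, s), hb1⟩ (z ⟨t, ne_zero_right ha1⟩)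
    simp only [Nz2.fst, Nz2.snd, Nz2.prod, map_mul] at h3 h4 ⊢
    rw [h4]
    simp only [mul_assoc, h3, Units.inv_mul_cancel_left]

noncomputable instance : Ring (TwistedRing c) :=
  { (inferInstance : AddCommGroup (TwistedRing c)), (inferInstance : Mul (TwistedRing c)),
    (inferInstance : One (TwistedRing c)) with
    left_distrib := fun x y z => by
      ext u
      simp only [mul_apply, add_apply, map_add, mul_add, add_mul, Finset.sum_add_distrib]
    right_distrib := fun x y z => by
      ext u
      simp only [mul_apply, add_apply, add_mul, Finset.sum_add_distrib]
    zero_mul := fun x => by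
      ext u
      simp only [mul_apply, zero_apply, zero_mul, Finset.sum_const_zero]
    mul_zero := fun x => by
      ext u
      simp only [mul_apply, zero_apply, map_zero, mul_zero, zero_mul, Finset.sum_const_zero]
    mul_assoc := TwistedRing.mul_assoc
    one_mul := TwistedRing.one_mul
    mul_one := TwistedRing.mul_one }

end TwistedRing

/-! ## Square-free rings -/

/-- A nonzero module that is not a direct sum of two nonzero submodules. -/
def IsIndecomposableModule (R M : Type*) [Ring R] [AddCommGroup M] [Module R M] : Prop :=
  Nontrivial M ∧ ∀ A B : Submodule R M, IsCompl A B → A = ⊥ ∨ B = ⊥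

/-- `M` has a composition series `0 = s 0 ⋖ s 1 ⋖ ⋯ ⋖ s n = M` in which every simple module
occurs at most once, that is, whose composition factors are pairwise nonisomorphic. -/
def HasMultiplicityFreeCompositionSeries (R M : Type*) [Ring R] [AddCommGroup M] [Module R M] :
    Prop :=
  ∃ (n : ℕ) (s : Fin (n + 1) → Submodule R M), s 0 = ⊥ ∧ s (Fin.last n) = ⊤ ∧
    (∀ i : Fin n, s i.castSucc ⋖ s i.succ) ∧
    ∀ i j : Fin n,
      Nonempty ((s i.succ ⧸ (s i.castSucc).submoduleOf (s i.succ)) ≃ₗ[R]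
        (s j.succ ⧸ (s j.castSucc).submoduleOf (s j.succ))) → i = j

/-- `R` is left square-free: in every indecomposable direct summand of the left module `R`, each
simple module has composition multiplicity at most one. -/
def IsLeftSquareFree (R : Type*) [Ring R] : Prop :=
  ∀ M : Submodule R R, (∃ N, IsCompl M N) → IsIndecomposableModule R M →
    HasMultiplicityFreeCompositionSeries R M

/-- `e` is a nonzero idempotent that is not a sum of two nonzero orthogonal idempotents. -/
def IsPrimitiveIdempotent {R : Type*} [Ring R] (e : R) : Prop :=
  IsIdempotentElem e ∧ e ≠ 0 ∧
    ∀ f g : R, IsIdempotentElem f → IsIdempotentElem g → f * g = 0 → g * f = 0 → f + g = e →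
      f = 0 ∨ g = 0

/-- `R` is basic: if `1 = e₁ + ⋯ + eₙ` with orthogonal primitive idempotents `eᵢ`, then the modules
`R eᵢ` are pairwise nonisomorphic, so that `{e₁, …, eₙ}` is a basic set of idempotents. (In an
artinian ring such a decomposition exists, and by Krull-Schmidt the condition is the same for all
of them.) -/
def IsBasicRing (R : Type*) [Ring R] : Prop :=
  ∀ (n : ℕ) (e : Fin n → R), CompleteOrthogonalIdempotents e →
    (∀ i, IsPrimitiveIdempotent (e i)) →
    ∀ i j, Nonempty (Submodule.span R {e i} ≃ₗ[R] Submodule.span R {e j}) → i = j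

/-- `R` is nonzero and is not a direct product of two nonzero rings. -/
def IsIndecomposableRing (R : Type*) [Ring R] : Prop :=
  Nontrivial R ∧ ∀ e : R, IsIdempotentElem e → (∀ x, e * x = x * e) → e = 0 ∨ e = 1

/-- A square-free ring: a basic indecomposable (left and right) artinian ring that is left and
right square-free. Right `R`-modules are left `Rᵐᵒᵖ`-modules. -/
structure IsSquareFreeRing (R : Type*) [Ring R] : Prop where
  artinian_left : IsArtinianRing R
  artinian_right : IsArtinianRing Rᵐᵒᵖ
  indecomposable : IsIndecomposableRing R
  basic : IsBasicRing R
  left : IsLeftSquareFree R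
  right : IsLeftSquareFree Rᵐᵒᵖ

/-! ## Outer automorphisms -/

/-- The group `Inn R` of maps `x ↦ r x r⁻¹` with `r` a unit of `R`. -/
def innAut (R : Type*) [Ring R] : Subgroup (RingAut R) where
  carrier := {γ | ∃ r : Rˣ, ∀ x : R, γ x = r * x * (r⁻¹ : Rˣ)}
  one_mem' := ⟨1, fun x => by simp⟩
  mul_mem' := by
    rintro γ δ ⟨r, hr⟩ ⟨t, ht⟩
    exact ⟨r * t, fun x => by simp [RingAut.mul_apply, hr, ht, mul_assoc]⟩
  inv_mem' := by
    rintro γ ⟨r, hr⟩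
    refine ⟨r⁻¹, fun x => ?_⟩
    rw [RingAut.inv_apply, RingEquiv.symm_apply_eq, hr]
    simp [mul_assoc]

instance (R : Type*) [Ring R] : (innAut R).Normal where
  conj_mem := by
    rintro δ ⟨r, hr⟩ γ
    refine ⟨Units.map (γ : R →* R) r, fun x => ?_⟩
    have e2 : γ (γ⁻¹ x) = x := γ.apply_symm_apply x
    simp only [RingAut.mul_apply, hr, map_mul, e2]
    simp

/-- `Out R = Aut R / Inn R`, where `Aut R` is the group of ring automorphisms. -/
abbrev Out (R : Type*) [Ring R] : Type _ := RingAut R ⧸ innAut R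

/-! Up to inner automorphisms, every automorphism of the twisted ring permutes the basis S* up to
scalars, and 1-cochains describe exactly these monomial automorphisms.

The elements `corner c e 1`, which are ξ(e,e)⁻¹e, are orthogonal primitive idempotents with sum 1.
Since R is basic, no two of them generate isomorphic left ideals, and this forces e in E to factor
in S only as e·e (`idempotentsIrreducible_of_isBasicRing`). The renormalized coefficient at e is
therefore a ring homomorphism to D (`character`), and an element killed by all characters is
nilpotent (`isNilpotent_of_character`). An automorphism γ carries the corner idempotents to another
complete orthogonal system; the characters match the two systems, and a unit conjugates one into the
other (`exists_innAut_mul_isMonomial`). Once γ permutes the corner idempotents, it maps D s to D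
φ(s) for some φ in Aut S, because eSf has at most one nonzero element (`exists_isMonomial`).

The scalars of a monomial automorphism over φ form a 1-cochain carrying (α^φ, ξ^φ) to (α, ξ), and
each such cochain gives a monomial automorphism; so the φ that occur are those of the stabilizer.
Over φ = 1 the cochain lies in Z¹. Coboundaries are conjugations by diagonal units, so H¹ = 1 makes
the automorphism inner (`IsMonomial.mem_innAut`). Conversely, the characters show that an inner
automorphism is monomial only over 1 (`IsMonomial.eq_one`). Hence γ ↦ φ is a well-defined surjection
of Aut R onto the stabilizer with kernel Inn R. -/

namespace TwistedRing

variable {S D : Type*} [SquareFreeSemigroup S] [DivisionRing D] {c : TwoCocycle S D}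

/-! ## Monomials and diagonal elements -/

open scoped Classical in
/-- The monomial `d s`. -/
noncomputable def single (c : TwoCocycle S D) (s : Nz S) (d : D) : TwistedRing c :=
  fun u => if u = s then d else 0

theorem single_same (s : Nz S) (d : D) : single c s d s = d := if_pos rfl

theorem single_of_ne {s u : Nz S} (h : u ≠ s) (d : D) : single c s d u = 0 := if_neg h

theorem single_injective (s : Nz S) : Function.Injective (single c s) := fun a b h => by
  rw [← single_same (c := c) s a, h, single_same]

theorem single_zero (s : Nz S) : single c s 0 = 0 := by
  ext u
  by_cases h : u = s
  · subst h; rw [single_same]; rfl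
  · rw [single_of_ne h]; rfl

theorem eq_of_single_eq {s t : Nz S} {a b : D} (ha : a ≠ 0) (h : single c s a = single c t b) :
    s = t := by
  by_contra hne
  apply ha
  rw [← single_same (c := c) s a, h, single_of_ne hne]

theorem eq_single {x : TwistedRing c} {s : Nz S} (h : ∀ u, u ≠ s → x u = 0) :
    x = single c s (x s) := by
  ext u
  by_cases hu : u = s
  · subst hu; rw [single_same]
  · rw [single_of_ne hu, h u hu]

/-- Additive maps that agree on monomials are equal. -/
theorem addMonoidHom_ext {M : Type*} [AddCommMonoid M] {f g : TwistedRing c →+ M}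
    (h : ∀ s d, f (single c s d) = g (single c s d)) : f = g := by
  classical
  have := Fintype.ofFinite (Nz S)
  ext x
  have hx : x = ∑ s, single c s (x s) := by
    ext u
    let ev : TwistedRing c →+ D := ⟨⟨fun y => y u, rfl⟩, fun _ _ => rfl⟩
    have h1 : ev (∑ s, single c s (x s)) = ∑ s, ev (single c s (x s)) := map_sum ev _ _
    have h2 : ∑ s, ev (single c s (x s)) = ev (single c u (x u)) :=
      Finset.sum_eq_single u (fun s _ hs => single_of_ne (c := c) (Ne.symm hs) _)
        (fun h => absurd (Finset.mem_univ _) h)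
    exact ((h1.trans h2).trans (single_same (c := c) u (x u))).symm
  rw [hx, map_sum, map_sum]
  exact Finset.sum_congr rfl fun s _ => h s (x s)

theorem single_mul_single (p : Nz2 S) (a b : D) :
    single c (Nz2.fst p) a * single c (Nz2.snd p) b
      = single c (Nz2.prod p) (a * c.1.α (Nz2.fst p) b * c.1.ξ p) := by
  classical
  ext u
  rw [mul_apply]
  by_cases hu : u = Nz2.prod p
  · subst hu
    rw [Finset.sum_eq_single p]
    · simp only [single_same]
    · intro q hq hne
      by_cases h1 : Nz2.fst q = Nz2.fst p
      · have h2 : Nz2.snd q ≠ Nz2.snd p := fun h2 => hne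
          (Subtype.ext (Prod.ext (congrArg Subtype.val h1) (congrArg Subtype.val h2)))
        rw [single_of_ne h2, map_zero, mul_zero, zero_mul]
      · rw [single_of_ne h1, zero_mul, zero_mul]
    · intro h
      exact absurd (by simp) h
  · rw [single_of_ne hu]
    refine Finset.sum_eq_zero fun q hq => ?_
    by_cases h1 : Nz2.fst q = Nz2.fst p
    · have h2 : Nz2.snd q ≠ Nz2.snd p := fun h2 => by
        have : q = p :=
          Subtype.ext (Prod.ext (congrArg Subtype.val h1) (congrArg Subtype.val h2))
        subst this
        exact hu (Finset.mem_filter.1 hq).2.symm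
      rw [single_of_ne h2, map_zero, mul_zero, zero_mul]
    · rw [single_of_ne h1, zero_mul, zero_mul]

theorem single_mul_single_of_eq_zero {s t : Nz S} (h : (s : S) * t = 0) (a b : D) :
    single c s a * single c t b = 0 := by
  classical
  ext u
  rw [mul_apply]
  refine Finset.sum_eq_zero fun q _ => ?_
  by_cases h1 : Nz2.fst q = s
  · have h2 : Nz2.snd q ≠ t := fun h2 => q.2 (by
      subst h1 h2; exact h)
    rw [single_of_ne h2, map_zero, mul_zero, zero_mul]
  · rw [single_of_ne h1, zero_mul, zero_mul]

/-! ### The diagonal subring -/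

open scoped Classical in
/-- The underlying function of `diag`. -/
noncomputable def diagFun (c : TwoCocycle S D) (a : Idem S → D) : TwistedRing c :=
  fun u => if h : (u : S) ∈ E (S := S) then a ⟨u, h⟩ * ((c.1.ξ (idemPair ⟨u, h⟩))⁻¹ : Dˣ) else 0

theorem diagFun_idem (a : Idem S → D) (e : Idem S) :
    diagFun c a (idemNz e) = a e * ((c.1.ξ (idemPair e))⁻¹ : Dˣ) := dif_pos e.2

theorem diagFun_of_notMem (a : Idem S → D) {u : Nz S} (h : (u : S) ∉ E (S := S)) :
    diagFun c a u = 0 := dif_neg h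

theorem lft_idemNz (e : Idem S) : lft (idemNz e) = e :=
  lft_eq (by show (e : S) * e ≠ 0; rw [idem _ e.2]; exact ne_zero_of_mem _ e.2)

theorem rgt_idemNz (e : Idem S) : rgt (idemNz e) = e :=
  rgt_eq (by show (e : S) * e ≠ 0; rw [idem _ e.2]; exact ne_zero_of_mem _ e.2)

/-- Only the pair (e, u) with e = `lft u` contributes. There ξ(e,u) = ξ(e,e) and α_e is conjugation
by ξ(e,e), so the normalizing factor ξ(e,e)⁻¹ cancels all twists. -/
theorem diagFun_mul_apply (a : Idem S → D) (x : TwistedRing c) (u : Nz S) :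
    (diagFun c a * x) u = a (lft u) * x u := by
  classical
  rw [mul_apply, Finset.sum_eq_single (leftPair u)]
  · have h1 : Nz2.fst (leftPair u) = idemNz (lft u) := rfl
    have h2 : Nz2.snd (leftPair u) = u := rfl
    rw [ξ_left c _ _ h1, h1, h2, diagFun_idem, α_idem]
    simp [mul_assoc]
  · intro p hp hne
    have hp' : Nz2.prod p = u := by simpa using hp
    rw [diagFun_of_notMem, zero_mul, zero_mul]
    intro hE
    exact hne (by rw [← hp']; exact eq_leftPair hE)
  · intro h
    exact absurd (by simpa using Subtype.ext (lft_mul u)) h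

theorem mul_diagFun_apply (a : Idem S → D) (x : TwistedRing c) (u : Nz S) :
    (x * diagFun c a) u = x u * c.1.α u (a (rgt u)) := by
  classical
  rw [mul_apply, Finset.sum_eq_single (rightPair u)]
  · have h1 : Nz2.snd (rightPair u) = idemNz (rgt u) := rfl
    have h2 : Nz2.fst (rightPair u) = u := rfl
    rw [ξ_right c _ _ h1, h1, h2, diagFun_idem, mul_assoc, ← map_mul]
    simp
  · intro p hp hne
    have hp' : Nz2.prod p = u := by simpa using hp
    rw [diagFun_of_notMem, map_zero, mul_zero, zero_mul]
    intro hE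
    exact hne (by rw [← hp']; exact eq_rightPair hE)
  · intro h
    exact absurd (by simpa using Subtype.ext (mul_rgt u)) h

/-- The diagonal embedding `a ↦ ∑ a(e) ξ(e,e)⁻¹ e`. -/
noncomputable def diag (c : TwoCocycle S D) : (Idem S → D) →+* TwistedRing c where
  toFun := diagFun c
  map_one' := by
    ext u
    by_cases h : (u : S) ∈ E (S := S)
    · have := one_apply_idem (c := c) ⟨u, h⟩
      have h2 := diagFun_idem (c := c) 1 ⟨u, h⟩
      simp only [Pi.one_apply, one_mul] at h2
      exact h2.trans this.symm
    · rw [diagFun_of_notMem _ h, one_apply_of_notMem h]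
  map_zero' := by
    ext u
    simp [diagFun, zero_apply]
  map_add' a b := by
    ext u
    rw [add_apply]
    by_cases h : (u : S) ∈ E (S := S) <;> simp [diagFun, h, add_mul]
  map_mul' a b := by
    ext u
    rw [diagFun_mul_apply]
    by_cases h : (u : S) ∈ E (S := S)
    · obtain ⟨e, rfl⟩ : ∃ e, u = idemNz e := ⟨⟨u, h⟩, rfl⟩
      rw [lft_idemNz, diagFun_idem, diagFun_idem, Pi.mul_apply, mul_assoc]
    · rw [diagFun_of_notMem _ h, diagFun_of_notMem _ h, mul_zero]

theorem diag_idem (a : Idem S → D) (e : Idem S) :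
    diag c a (idemNz e) = a e * ((c.1.ξ (idemPair e))⁻¹ : Dˣ) := diagFun_idem a e

theorem diag_mul_apply (a : Idem S → D) (x : TwistedRing c) (u : Nz S) :
    (diag c a * x) u = a (lft u) * x u := diagFun_mul_apply a x u

theorem mul_diag_apply (a : Idem S → D) (x : TwistedRing c) (u : Nz S) :
    (x * diag c a) u = x u * c.1.α u (a (rgt u)) := mul_diagFun_apply a x u

theorem diag_injective : Function.Injective (diag c) := fun a b h => by
  funext e
  have := congrFun h (idemNz e)
  rw [diag_idem, diag_idem] at this
  exact mul_right_cancel₀ (Units.ne_zero _) this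

theorem diag_mul_single (a : Idem S → D) (s : Nz S) (d : D) :
    diag c a * single c s d = single c s (a (lft s) * d) := by
  ext u
  rw [diag_mul_apply]
  by_cases h : u = s
  · subst h; rw [single_same, single_same]
  · rw [single_of_ne h, single_of_ne h, mul_zero]

theorem single_mul_diag (a : Idem S → D) (s : Nz S) (d : D) :
    single c s d * diag c a = single c s (d * c.1.α s (a (rgt s))) := by
  ext u
  rw [mul_diag_apply]
  by_cases h : u = s
  · subst h; rw [single_same, single_same]
  · rw [single_of_ne h, single_of_ne h, zero_mul]

/-! ### Corner rings -/

open scoped Classical in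
/-- The element `d` of the corner ring at `e`, which is a copy of `D`. -/
noncomputable def corner (c : TwoCocycle S D) (e : Idem S) (d : D) : TwistedRing c :=
  diag c (Pi.single e d)

theorem corner_eq_single (e : Idem S) (d : D) :
    corner c e d = single c (idemNz e) (d * ((c.1.ξ (idemPair e))⁻¹ : Dˣ)) := by
  classical
  ext u
  by_cases h : (u : S) ∈ E (S := S)
  · obtain ⟨f, rfl⟩ : ∃ e, u = idemNz e := ⟨⟨u, h⟩, rfl⟩
    rw [corner, diag_idem]
    by_cases hf : f = e
    · subst hf; rw [single_same, Pi.single_eq_same]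
    · have : idemNz f ≠ idemNz e := fun h' => hf (Subtype.ext (congrArg (fun s : Nz S => (s : S)) h'))
      rw [single_of_ne this, Pi.single_eq_of_ne hf, zero_mul]
  · rw [single_of_ne (by rintro rfl; exact h e.2)]
    exact diagFun_of_notMem _ h

theorem single_idem (e : Idem S) (d : D) :
    single c (idemNz e) d = corner c e (d * c.1.ξ (idemPair e)) := by
  rw [corner_eq_single]; simp

theorem corner_mul (e : Idem S) (a b : D) : corner c e a * corner c e b = corner c e (a * b) := by
  classical
  rw [corner, corner, corner, ← map_mul, ← Pi.single_mul]

theorem corner_add (e : Idem S) (a b : D) : corner c e a + corner c e b = corner c e (a + b) := by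
  classical
  rw [corner, corner, corner, ← map_add, ← Pi.single_add]

theorem corner_injective (e : Idem S) : Function.Injective (corner c e) := by
  classical
  exact diag_injective.comp (Pi.single_injective e)

theorem corner_zero (e : Idem S) : corner c e 0 = 0 := by
  classical
  rw [corner, Pi.single_zero, map_zero]

theorem isIdempotentElem_corner_one (e : Idem S) : IsIdempotentElem (corner c e 1) := by
  rw [IsIdempotentElem, corner_mul, one_mul]

theorem corner_one_mul_corner_one {e f : Idem S} (h : e ≠ f) :
    corner c e 1 * corner c f 1 = 0 := by
  classical
  rw [corner, corner, ← map_mul]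
  convert map_zero (diag c)
  funext i
  by_cases hi : i = e
  · subst hi; simp [h]
  · simp [hi]

theorem sum_corner_one [Fintype (Idem S)] : ∑ e, corner c e 1 = 1 := by
  classical
  simp only [corner]
  rw [← map_sum, ← map_one (diag c)]
  congr 1
  exact Finset.univ_sum_single 1

theorem corner_mul_single {e : Idem S} {s : Nz S} (h : lft s = e) (a d : D) :
    corner c e a * single c s d = single c s (a * d) := by
  classical
  rw [corner, diag_mul_single, h, Pi.single_eq_same]

theorem single_mul_corner {f : Idem S} {s : Nz S} (h : rgt s = f) (a d : D) :
    single c s d * corner c f a = single c s (d * c.1.α s a) := by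
  classical
  rw [corner, single_mul_diag, h, Pi.single_eq_same]

theorem apply_eq_zero_of_lft {x : TwistedRing c} {e : Idem S} (hx : corner c e 1 * x = x)
    {u : Nz S} (hu : lft u ≠ e) : x u = 0 := by
  classical
  rw [← hx, corner, diag_mul_apply, Pi.single_eq_of_ne hu, zero_mul]

theorem apply_eq_zero_of_rgt {x : TwistedRing c} {e : Idem S} (hx : x * corner c e 1 = x)
    {u : Nz S} (hu : rgt u ≠ e) : x u = 0 := by
  classical
  rw [← hx, corner, mul_diag_apply, Pi.single_eq_of_ne hu, map_zero, mul_zero]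

/-- The two corner idempotents kill every basis element outside eSf, and s is the only nonzero
element of eSf. -/
theorem eq_single_of_corner {x : TwistedRing c} {s : Nz S} (h1 : corner c (lft s) 1 * x = x)
    (h2 : x * corner c (rgt s) 1 = x) : x = single c s (x s) := by
  refine eq_single fun u hu => ?_
  by_cases h : lft u = lft s
  · exact apply_eq_zero_of_rgt h2 fun h' => hu (eq_of_lft_rgt h h')
  · exact apply_eq_zero_of_lft h1 h

theorem eq_corner {x : TwistedRing c} {e : Idem S} (h1 : corner c e 1 * x = x)
    (h2 : x * corner c e 1 = x) : ∃ d, x = corner c e d := by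
  refine ⟨x (idemNz e) * c.1.ξ (idemPair e), ?_⟩
  rw [← single_idem]
  apply eq_single_of_corner
  · rwa [lft_idemNz]
  · rwa [rgt_idemNz]

/-- Orthogonal summands of the idempotent lie in its corner ring, a copy of D, which has no zero
divisors. -/
theorem isPrimitiveIdempotent_corner_one (e : Idem S) :
    IsPrimitiveIdempotent (corner c e 1) := by
  refine ⟨isIdempotentElem_corner_one e, fun h => one_ne_zero
    (corner_injective e (h.trans (corner_zero e).symm)), ?_⟩
  intro f g hf hg hfg hgf hsum
  obtain ⟨a, rfl⟩ : ∃ d, f = corner c e d := by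
    apply eq_corner
    · rw [← hsum, add_mul, hgf, add_zero, hf]
    · rw [← hsum, mul_add, hfg, add_zero, hf]
  obtain ⟨b, rfl⟩ : ∃ d, g = corner c e d := by
    apply eq_corner
    · rw [← hsum, add_mul, hfg, zero_add, hg]
    · rw [← hsum, mul_add, hgf, zero_add, hg]
  rw [corner_mul, ← corner_zero e] at hfg
  rcases mul_eq_zero.1 (corner_injective e hfg) with h | h
  · exact Or.inl (by rw [h, corner_zero])
  · exact Or.inr (by rw [h, corner_zero])

end TwistedRing

/-! ## Basicness -/

/-- Isomorphic idempotents generate isomorphic left ideals. -/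
theorem nonempty_span_equiv {R : Type*} [Ring R] {e f x y : R} (hex : e * x = x) (hxf : x * f = x)
    (hfy : f * y = y) (hye : y * e = y) (hxy : x * y = e) (hyx : y * x = f) :
    Nonempty (Submodule.span R {e} ≃ₗ[R] Submodule.span R {f}) := by
  have he : ∀ z ∈ Submodule.span R {e}, z * e = z := by
    intro z hz
    obtain ⟨a, rfl⟩ := Submodule.mem_span_singleton.1 hz
    rw [smul_eq_mul, mul_assoc, ← hxy, mul_assoc, ← mul_assoc y x y, hyx, hfy]
  have hf : ∀ z ∈ Submodule.span R {f}, z * f = z := by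
    intro z hz
    obtain ⟨a, rfl⟩ := Submodule.mem_span_singleton.1 hz
    rw [smul_eq_mul, mul_assoc, ← hyx, mul_assoc, ← mul_assoc x y x, hxy, hex]
  -- Right multiplication by x and right multiplication by y are inverse to each other.
  refine ⟨LinearEquiv.ofLinearMap
    (((LinearMap.toSpanSingleton R R x).domRestrict _).codRestrict _ fun z => ?_)
    (((LinearMap.toSpanSingleton R R y).domRestrict _).codRestrict _ fun z => ?_) ?_ ?_⟩
  · exact Submodule.mem_span_singleton.2 ⟨z.1 * x, by simp [mul_assoc, hxf]⟩
  · exact Submodule.mem_span_singleton.2 ⟨z.1 * y, by simp [mul_assoc, hye]⟩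
  · ext z
    show (z : R) * y * x = z
    rw [mul_assoc, hyx, hf z z.2]
  · ext z
    show (z : R) * x * y = z
    rw [mul_assoc, hxy, he z z.2]

/-- Basicness in a form ready for use: any finite index type, idempotents in an isomorphic ring, and
the isomorphism of left ideals witnessed by x and y. -/
theorem IsBasicRing.of_ringEquiv {R R' : Type*} [Ring R] [Ring R'] (h : IsBasicRing R)
    (f : R ≃+* R') {ι : Type*} [Finite ι] {e : ι → R'}
    (he : ∀ i, IsPrimitiveIdempotent (e i)) (ho : ∀ i j, i ≠ j → e i * e j = 0)
    (hs : ∀ [Fintype ι], ∑ i, e i = 1) {i j : ι} {x y : R'} (hex : e i * x = x)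
    (hxf : x * e j = x) (hfy : e j * y = y) (hye : y * e i = y) (hxy : x * y = e i)
    (hyx : y * x = e j) : i = j := by
  classical
  have := Fintype.ofFinite ι
  obtain ⟨n, ⟨k⟩⟩ := Finite.exists_equiv_fin ι
  have key := h n (fun a => f.symm (e (k.symm a))) ?_ ?_ (k i) (k j) ?_
  · exact k.injective key
  · refine ⟨⟨fun a => ?_, fun a b hab => ?_⟩, ?_⟩
    · exact (he _).1.map f.symm
    · show f.symm _ * f.symm _ = 0
      rw [← map_mul, ho _ _ (fun h' => hab (k.symm.injective h')), map_zero]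
    · rw [← map_sum, Equiv.sum_comp k.symm, hs, map_one]
  · intro a
    obtain ⟨h1, h2, h3⟩ := he (k.symm a)
    refine ⟨h1.map f.symm, by simpa using h2, fun p q hp hq hpq hqp hsum => ?_⟩
    have := h3 (f p) (f q) (hp.map f) (hq.map f) (by rw [← map_mul, hpq, map_zero])
      (by rw [← map_mul, hqp, map_zero]) (by rw [← map_add, hsum, RingEquiv.apply_symm_apply])
    simpa using this
  · apply nonempty_span_equiv (x := f.symm x) (y := f.symm y) <;>
      simp only [Equiv.symm_apply_apply, ← map_mul, hex, hxf, hfy, hye, hxy, hyx]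

/-- The only factorization of an idempotent `e ∈ E` is `e = e · e`. -/
def IdempotentsIrreducible (S : Type*) [SquareFreeSemigroup S] : Prop :=
  ∀ s t : S, s * t ∈ E (S := S) → s = s * t ∧ t = s * t

namespace TwistedRing

variable {S D : Type*} [SquareFreeSemigroup S] [DivisionRing D] {c : TwoCocycle S D}

/-- If s·t = e, suitable multiples x of s and y of t satisfy xy = `corner c e 1`. Then yx is a
nonzero idempotent in the corner at f, the right end of s, hence its identity. The idempotents at e
and f are thus isomorphic, so e = f, and uniqueness in eSe gives s = t = e. -/
theorem idempotentsIrreducible_of_isBasicRing {R : Type*} [Ring R] (hR : IsBasicRing R)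
    (φ : R ≃+* TwistedRing c) : IdempotentsIrreducible S := by
  intro s t hst
  let p : Nz2 S := ⟨(s, t), ne_zero_of_mem _ hst⟩
  let e : Idem S := ⟨s * t, hst⟩
  have hpe : Nz2.prod p = idemNz e := rfl
  have h1 : lft (Nz2.fst p) = e := by rw [← lft_prod, hpe, lft_idemNz]
  have h2 : rgt (Nz2.snd p) = e := by rw [← rgt_prod, hpe, rgt_idemNz]
  set f := rgt (Nz2.fst p) with hf
  have h3 : lft (Nz2.snd p) = f := lft_snd p
  -- The choice makes α_s(b) ξ(s,t) = ξ(e,e)⁻¹, the coefficient of `corner c e 1`.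
  obtain ⟨b, hb⟩ := (c.1.α (Nz2.fst p)).surjective
    (((c.1.ξ (idemPair e))⁻¹ : Dˣ) * ((c.1.ξ p)⁻¹ : Dˣ))
  set x := single c (Nz2.fst p) 1 with hx
  set y := single c (Nz2.snd p) b with hy
  have hxy : x * y = corner c e 1 := by
    rw [hx, hy, single_mul_single, hb, hpe, corner_eq_single]
    simp
  have hex : corner c e 1 * x = x := by rw [hx, corner_mul_single h1, one_mul]
  have hxf : x * corner c f 1 = x := by rw [hx, single_mul_corner hf.symm, map_one, mul_one]
  have hfy : corner c f 1 * y = y := by rw [hy, corner_mul_single h3, one_mul]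
  have hye : y * corner c e 1 = y := by rw [hy, single_mul_corner h2, map_one, mul_one]
  have hyx : y * x = corner c f 1 := by
    obtain ⟨a, ha⟩ : ∃ a, y * x = corner c f a := by
      apply eq_corner
      · rw [← mul_assoc, hfy]
      · rw [mul_assoc, hxf]
    have h4 : corner c f (a * a) = corner c f a := by
      rw [← corner_mul, ← ha, mul_assoc, ← mul_assoc x, hxy, hex]
    have h5 : a ≠ 0 := by
      rintro rfl
      have : x * (y * x) = x := by rw [← mul_assoc, hxy, hex]
      rw [ha, corner_zero, mul_zero] at this
      have h6 := congrFun this (Nz2.fst p)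
      rw [hx, single_same] at h6
      exact zero_ne_one h6
    rw [ha, mul_left_cancel₀ h5 ((corner_injective f h4).trans (mul_one a).symm)]
  have hef : e = f := hR.of_ringEquiv φ (e := fun e => corner c e 1)
    isPrimitiveIdempotent_corner_one (fun _ _ => corner_one_mul_corner_one) sum_corner_one
    hex hxf hfy hye hxy hyx
  constructor
  · exact congrArg Subtype.val (eq_of_lft_rgt (s := Nz2.fst p) (t := idemNz e)
      (by rw [h1, lft_idemNz]) (by rw [← hf, ← hef, rgt_idemNz]))
  · exact congrArg Subtype.val (eq_of_lft_rgt (s := Nz2.snd p) (t := idemNz e)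
      (by rw [h3, ← hef, lft_idemNz]) (by rw [h2, rgt_idemNz]))

/-! ## The characters of the twisted ring and its radical -/

/-- This leaves a single term in the coefficient of a product at e, which is why characters are
multiplicative. -/
theorem eq_idemPair (hS : IdempotentsIrreducible S) {p : Nz2 S} {e : Idem S}
    (h : Nz2.prod p = idemNz e) : p = idemPair e := by
  have h0 : p.1.1 * p.1.2 = e := congrArg Subtype.val h
  obtain ⟨h1, h2⟩ := hS p.1.1 p.1.2 (by rw [h0]; exact e.2)
  exact Subtype.ext (Prod.ext (h1.trans h0) (h2.trans h0))

theorem prod_idemPair (e : Idem S) : Nz2.prod (idemPair e) = idemNz e :=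
  Subtype.ext (idem _ e.2)

/-- The ring homomorphism onto `D` at the vertex `e`. -/
noncomputable def character (c : TwoCocycle S D) (hS : IdempotentsIrreducible S) (e : Idem S) :
    TwistedRing c →+* D where
  toFun x := x (idemNz e) * c.1.ξ (idemPair e)
  map_one' := by rw [one_apply_idem, Units.inv_mul]
  map_zero' := by rw [zero_apply, zero_mul]
  map_add' x y := by rw [add_apply, add_mul]
  map_mul' x y := by
    classical
    rw [mul_apply, Finset.sum_eq_single (idemPair e)]
    · have h1 : Nz2.fst (idemPair e) = idemNz e := rfl
      have h2 : Nz2.snd (idemPair e) = idemNz e := rfl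
      rw [h1, h2, α_idem]
      simp [mul_assoc]
    · intro p hp hne
      exact absurd (eq_idemPair hS (Finset.mem_filter.1 hp).2) hne
    · intro h
      exact absurd (by simpa using prod_idemPair e) h

theorem character_apply (hS : IdempotentsIrreducible S) (e : Idem S) (x : TwistedRing c) :
    character c hS e x = x (idemNz e) * c.1.ξ (idemPair e) := rfl

theorem character_corner_same (hS : IdempotentsIrreducible S) (e : Idem S) (d : D) :
    character c hS e (corner c e d) = d := by
  rw [corner_eq_single, character_apply, single_same, Units.inv_mul_cancel_right]

theorem idemNz_injective : Function.Injective (idemNz (S := S)) := fun _ _ h =>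
  Subtype.ext (congrArg (fun s : Nz S => (s : S)) h)

theorem character_corner_of_ne (hS : IdempotentsIrreducible S) {e f : Idem S} (h : e ≠ f)
    (d : D) : character c hS e (corner c f d) = 0 := by
  rw [corner_eq_single, character_apply, single_of_ne (fun h' => h (idemNz_injective h')),
    zero_mul]

/-- The number of nonzero elements of the left ideal generated by `t`. -/
noncomputable def leftIdealCard (t : Nz S) : ℕ := {x : Nz S | ∃ u : S, (x : S) = u * t}.ncard

/-- For p = (s, t) the left ideal of s·t lies in that of t. If it contained t, then t = u·s·t, so
f·u·s would be a nonzero element of fSf with f the left end of t. It would equal f, and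
irreducibility would put s in E. -/
theorem leftIdealCard_prod_lt (hS : IdempotentsIrreducible S) (p : Nz2 S)
    (hp : p.1.1 ∉ E (S := S)) : leftIdealCard (Nz2.prod p) < leftIdealCard (Nz2.snd p) := by
  refine Set.ncard_lt_ncard ((Set.ssubset_iff_of_subset ?_).2 ?_) (Set.toFinite _)
  · rintro x ⟨u, hu⟩
    exact ⟨u * p.1.1, by rw [hu, mul_assoc]; rfl⟩
  · refine ⟨Nz2.snd p, ⟨lft (Nz2.snd p), (lft_mul _).symm⟩, ?_⟩
    rintro ⟨u, hu⟩
    have hu' : p.1.2 = u * (p.1.1 * p.1.2) := hu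
    set f := lft (Nz2.snd p) with hf
    have h0 : (f : S) * u * p.1.1 ≠ 0 := by
      intro h
      have h1 : (f : S) * p.1.2 = p.1.2 := lft_mul (Nz2.snd p)
      rw [hu', ← mul_assoc, ← mul_assoc, h, zero_mul] at h1
      have h2 : p.1.2 = 0 := by rw [hu', ← h1]
      exact (Nz2.snd p).2 h2
    let q : Nz2 S := ⟨((f : S) * u, p.1.1), h0⟩
    have hq : Nz2.prod q = idemNz f := by
      apply eq_of_lft_rgt
      · rw [lft_idemNz]
        refine lft_eq ?_
        show (f : S) * (f * u * p.1.1) ≠ 0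
        rw [← mul_assoc, ← mul_assoc, idem _ f.2]; exact h0
      · rw [rgt_idemNz, rgt_prod]
        exact (lft_snd p).symm
    have h3 := eq_idemPair hS hq
    have h4 : p.1.1 = f := congrArg (fun q : Nz2 S => q.1.2) h3
    exact hp (h4 ▸ f.2)

/-- Such an x has no coefficients on E, so each further factor x strictly shrinks the left ideals of
the elements in the support. Since S* is finite, this stops. -/
theorem isNilpotent_of_character (hS : IdempotentsIrreducible S) {x : TwistedRing c}
    (hx : ∀ e, character c hS e x = 0) : IsNilpotent x := by
  classical
  have hx' : ∀ u : Nz S, (u : S) ∈ E (S := S) → x u = 0 := fun u hu =>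
    (mul_eq_zero.1 (hx ⟨u, hu⟩)).resolve_right (Units.ne_zero _)
  have key : ∀ (k : ℕ) (u : Nz S), (x ^ k) u ≠ 0 → leftIdealCard u + k ≤ Nat.card (Nz S) := by
    intro k
    induction k with
    | zero => exact fun u _ => Set.ncard_le_card _
    | succ k ih =>
      intro u hu
      rw [pow_succ', mul_apply] at hu
      obtain ⟨p, hp, hne⟩ := Finset.exists_ne_zero_of_sum_ne_zero hu
      have hp' := (Finset.mem_filter.1 hp).2
      have h1 : p.1.1 ∉ E (S := S) := fun h => hne (by
        rw [hx' (Nz2.fst p) h, zero_mul, zero_mul])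
      have h2 : (x ^ k) (Nz2.snd p) ≠ 0 := fun h => hne (by
        rw [h, map_zero, mul_zero, zero_mul])
      have h3 := leftIdealCard_prod_lt hS p h1
      have h4 := ih _ h2
      rw [hp'] at h3
      omega
  refine ⟨Nat.card (Nz S) + 1, ?_⟩
  ext u
  by_contra h
  have := key _ u h
  omega

/-! ## Monomial automorphisms -/

/-- `γ` maps `D s` into `D φ(s)` for every `s`. -/
def IsMonomial (γ : RingAut (TwistedRing c)) (φ : MulAut S) : Prop :=
  ∀ s d, ∃ d', γ (single c s d) = single c (autNz φ s) d'

theorem IsMonomial.mul {γ δ : RingAut (TwistedRing c)} {φ ψ : MulAut S} (hγ : IsMonomial γ φ)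
    (hδ : IsMonomial δ ψ) : IsMonomial (γ * δ) (φ * ψ) := by
  intro s d
  obtain ⟨d', h⟩ := hδ s d
  obtain ⟨d'', h'⟩ := hγ (autNz ψ s) d'
  exact ⟨d'', by rw [RingAut.mul_apply, h, h']; rfl⟩

theorem IsMonomial.map_corner {γ : RingAut (TwistedRing c)} {φ : MulAut S} (hγ : IsMonomial γ φ)
    (e : Idem S) (d : D) : ∃ d', γ (corner c e d) = corner c (autIdem φ e) d' := by
  rw [corner_eq_single]
  obtain ⟨d', h⟩ := hγ (idemNz e) (d * ((c.1.ξ (idemPair e))⁻¹ : Dˣ))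
  exact ⟨_, h.trans (single_idem (autIdem φ e) d')⟩

/-- The image is a nonzero idempotent in a copy of the division ring D. -/
theorem IsMonomial.map_corner_one {γ : RingAut (TwistedRing c)} {φ : MulAut S}
    (hγ : IsMonomial γ φ) (e : Idem S) : γ (corner c e 1) = corner c (autIdem φ e) 1 := by
  obtain ⟨d, h⟩ := hγ.map_corner e 1
  have h1 : corner c (autIdem φ e) (d * d) = corner c (autIdem φ e) d := by
    rw [← corner_mul, ← h, ← map_mul, corner_mul, one_mul]
  have h2 : d ≠ 0 := by
    rintro rfl
    rw [corner_zero, map_eq_zero_iff γ γ.injective, ← corner_zero e] at h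
    exact one_ne_zero (corner_injective e h)
  rw [h, mul_left_cancel₀ h2 ((corner_injective _ h1).trans (mul_one d).symm)]

theorem exists_map_single {γ : RingAut (TwistedRing c)} {s t : Nz S}
    (h1 : γ (corner c (lft s) 1) = corner c (lft t) 1)
    (h2 : γ (corner c (rgt s) 1) = corner c (rgt t) 1) (d : D) :
    ∃ d', γ (single c s d) = single c t d' := by
  refine ⟨_, eq_single_of_corner ?_ ?_⟩
  · rw [← h1, ← map_mul, corner_mul_single rfl, one_mul]
  · rw [← h2, ← map_mul, single_mul_corner rfl, map_one, mul_one]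

theorem IsMonomial.inv {γ : RingAut (TwistedRing c)} {φ : MulAut S} (hγ : IsMonomial γ φ) :
    IsMonomial γ⁻¹ φ⁻¹ := by
  have key : ∀ e, γ⁻¹ (corner c e 1) = corner c (autIdem φ⁻¹ e) 1 := fun e => by
    rw [RingAut.inv_apply, RingEquiv.symm_apply_eq, hγ.map_corner_one]
    congr 1
    exact Subtype.ext (φ.apply_symm_apply e).symm
  intro s d
  apply exists_map_single
  · rw [autIdem_lft, key]
  · rw [autIdem_rgt, key]

theorem single_ne_zero (s : Nz S) {d : D} (hd : d ≠ 0) : single c s d ≠ 0 := fun h =>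
  hd (single_injective s (h.trans (single_zero s).symm))

/-- An automorphism that permutes the idempotents `ξ(e,e)⁻¹ e` is monomial. -/
theorem exists_isMonomial {γ : RingAut (TwistedRing c)} {π : Idem S → Idem S}
    (hπ : Function.Injective π) (h : ∀ e, γ (corner c e 1) = corner c (π e) 1) :
    ∃ φ, IsMonomial γ φ := by
  classical
  -- The image of s is nonzero and lies between the idempotents at π(`lft s`) and π(`rgt s`), so any
  -- t in its support has the required ends.
  have h1 : ∀ s : Nz S, ∃ t : Nz S, lft t = π (lft s) ∧ rgt t = π (rgt s) := by
    intro s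
    have hne : γ (single c s 1) ≠ 0 := fun h' => single_ne_zero s one_ne_zero
      ((map_eq_zero_iff γ γ.injective).1 h')
    obtain ⟨t, ht⟩ : ∃ t, γ (single c s 1) t ≠ 0 := by
      by_contra! hcon
      exact hne (ext hcon)
    refine ⟨t, ?_, ?_⟩
    · by_contra hcon
      refine ht (apply_eq_zero_of_lft ?_ hcon)
      rw [← h, ← map_mul, corner_mul_single rfl, one_mul]
    · by_contra hcon
      refine ht (apply_eq_zero_of_rgt ?_ hcon)
      rw [← h, ← map_mul, single_mul_corner rfl, map_one, mul_one]
  choose τ hl hr using h1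
  have hτ : Function.Injective τ := fun s t hst => eq_of_lft_rgt
    (hπ (by rw [← hl, ← hl, hst])) (hπ (by rw [← hr, ← hr, hst]))
  have hτ' : Function.Surjective τ := Finite.surjective_of_injective hτ
  have hγ : ∀ s d, ∃ d', γ (single c s d) = single c (τ s) d' := fun s d =>
    exists_map_single (by rw [h, hl]) (by rw [h, hr]) d
  have hγ' : ∀ s d, d ≠ 0 → ∃ d', d' ≠ 0 ∧ γ (single c s d) = single c (τ s) d' := by
    intro s d hd
    obtain ⟨d', h'⟩ := hγ s d
    refine ⟨d', ?_, h'⟩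
    rintro rfl
    rw [single_zero, map_eq_zero_iff γ γ.injective] at h'
    exact single_ne_zero s hd h'
  -- Extend τ by θ ↦ θ. It is multiplicative because a product of nonzero monomials vanishes exactly
  -- when the product in S is θ, and γ preserves products.
  let F : S → S := fun s => if hs : s = 0 then 0 else τ ⟨s, hs⟩
  have F0 : F 0 = 0 := dif_pos rfl
  have F1 : ∀ s : Nz S, F s = τ s := fun s => dif_neg s.2
  have Fmul : ∀ s t, F (s * t) = F s * F t := by
    intro s t
    by_cases hs : s = 0
    · rw [hs, zero_mul, F0, zero_mul]
    by_cases ht : t = 0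
    · rw [ht, mul_zero, F0, mul_zero]
    lift s to Nz S using hs
    lift t to Nz S using ht
    rw [F1, F1]
    obtain ⟨a, ha, hs'⟩ := hγ' s 1 one_ne_zero
    obtain ⟨b, hb, ht'⟩ := hγ' t 1 one_ne_zero
    have hab : γ (single c s 1 * single c t 1) = single c (τ s) a * single c (τ t) b := by
      rw [map_mul, hs', ht']
    by_cases hst : (s : S) * t = 0
    · rw [hst, F0]
      by_contra hcon
      rw [single_mul_single_of_eq_zero hst, map_zero] at hab
      have h2 := single_mul_single (c := c) ⟨(τ s, τ t), Ne.symm hcon⟩ a b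
      refine single_ne_zero _ ?_ (h2.symm.trans hab.symm)
      exact mul_ne_zero (mul_ne_zero ha ((map_ne_zero _).2 hb)) (Units.ne_zero _)
    · have h2 := single_mul_single (c := c) ⟨(s, t), hst⟩ 1 1
      obtain ⟨d, hd, h3⟩ := hγ' (Nz2.prod ⟨(s, t), hst⟩)
        (1 * c.1.α s 1 * c.1.ξ ⟨(s, t), hst⟩) (by simp)
      have h4 : single c (τ (Nz2.prod ⟨(s, t), hst⟩)) d = single c (τ s) a * single c (τ t) b := by
        rw [← hab, ← h3]
        exact congrArg γ h2.symm
      have h5 : (τ s : S) * τ t ≠ 0 := fun h5 => single_ne_zero _ hd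
        (h4.trans (single_mul_single_of_eq_zero h5 a b))
      have h6 := h4.trans (single_mul_single (c := c) ⟨(τ s, τ t), h5⟩ a b)
      exact (F1 _).trans (congrArg Subtype.val (eq_of_single_eq hd h6))
  have Finj : Function.Injective F := by
    intro s t hst
    by_cases hs : s = 0 <;> by_cases ht : t = 0
    · rw [hs, ht]
    · lift t to Nz S using ht
      rw [hs, F0, F1] at hst
      exact absurd hst.symm (τ t).2
    · lift s to Nz S using hs
      rw [ht, F0, F1] at hst
      exact absurd hst (τ s).2
    · lift s to Nz S using hs
      lift t to Nz S using ht
      rw [F1, F1] at hst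
      rw [hτ (Subtype.ext hst)]
  have Fsurj : Function.Surjective F := by
    intro t
    by_cases ht : t = 0
    · exact ⟨0, by rw [ht, F0]⟩
    · lift t to Nz S using ht
      obtain ⟨s, rfl⟩ := hτ' t
      exact ⟨s, F1 s⟩
  refine ⟨MulEquiv.ofBijective (⟨F, Fmul⟩ : S →ₙ* S) ⟨Finj, Fsurj⟩, fun s d => ?_⟩
  obtain ⟨d', h'⟩ := hγ s d
  refine ⟨d', h'.trans ?_⟩
  congr 1
  exact Subtype.ext (F1 s).symm

/-- A monomial automorphism is given by a 1-cochain. -/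
theorem IsMonomial.exists_oneCochain {γ : RingAut (TwistedRing c)} {φ : MulAut S}
    (hγ : IsMonomial γ φ) : ∃ g : OneCochain S D, g.Transforms (TwoCocycle.pull φ c).1 c.1 ∧
      ∀ s d, γ (single c s d) = single c (autNz φ s) (g.μ (lft s) d * g.η s) := by
  -- The action `m e` of γ on the copy of D at e becomes μ_e, and the scalar `k s 1` in the image of
  -- s becomes η(s).
  choose m hm using hγ.map_corner
  have hk' := id hγ
  choose k hk using hk'
  let m' : Idem S → D →+* D := fun e =>
    { toFun := m e
      map_one' := corner_injective _ ((hm e 1).symm.trans (hγ.map_corner_one e))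
      map_zero' := corner_injective _ (by rw [← hm, corner_zero, corner_zero, map_zero])
      map_mul' := fun a b => corner_injective (c := c) (autIdem φ e) (by
        rw [← hm, ← corner_mul, map_mul, hm, hm, corner_mul])
      map_add' := fun a b => corner_injective (c := c) (autIdem φ e) (by
        rw [← hm, ← corner_add, map_add, hm, hm, corner_add]) }
  have hm' : ∀ e, Function.Bijective (m' e) := fun e => by
    refine ⟨(m' e).injective, fun d => ?_⟩
    obtain ⟨d', h⟩ := hγ.inv.map_corner (autIdem φ e) d
    have h1 : autIdem φ⁻¹ (autIdem φ e) = e := Subtype.ext (φ.symm_apply_apply e)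
    rw [h1, RingAut.inv_apply, RingEquiv.symm_apply_eq, hm] at h
    exact ⟨d', (corner_injective _ h).symm⟩
  have hk0 : ∀ s, k s 1 ≠ 0 := fun s h => by
    have h1 := hk s 1
    rw [h, single_zero, map_eq_zero_iff γ γ.injective] at h1
    exact single_ne_zero s one_ne_zero h1
  have key : ∀ s d, γ (single c s d) = single c (autNz φ s) (m (lft s) d * k s 1) := by
    intro s d
    have h1 : single c s d = corner c (lft s) d * single c s 1 := by
      rw [corner_mul_single rfl, mul_one]
    rw [h1, map_mul, hm, hk, corner_mul_single (autIdem_lft φ s)]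
  refine ⟨⟨fun e => RingEquiv.ofBijective (m' e) (hm' e), fun s => Units.mk0 (k s 1) (hk0 s)⟩,
    ⟨fun s x => ?_, fun p => ?_⟩, key⟩
  · obtain ⟨y, rfl⟩ := (RingEquiv.ofBijective (m' (rgt s)) (hm' (rgt s))).surjective x
    rw [RingEquiv.symm_apply_apply, Units.eq_mul_inv_iff_mul_eq]
    -- The condition on α is the image under γ of the rule for moving a scalar across s.
    have h1 : single c s (c.1.α s y) = single c s 1 * corner c (rgt s) y := by
      rw [single_mul_corner rfl, one_mul]
    have h2 := congrArg γ h1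
    rw [map_mul, key, hm, hk, single_mul_corner (autIdem_rgt φ s)] at h2
    exact single_injective _ h2
  · rw [Units.eq_mul_inv_iff_mul_eq]
    -- The condition on ξ is the image under γ of the product rule for s and t.
    have h2 := congrArg γ (single_mul_single (c := c) p 1 1)
    have h3 := single_mul_single (c := c) (autNz2 φ p) (k (Nz2.fst p) 1) (k (Nz2.snd p) 1)
    rw [map_mul, hk, hk, key, ← autNz2_prod, lft_prod, map_one, one_mul, one_mul] at h2
    exact single_injective _ (h2.symm.trans h3)

/-- A 1-cochain carrying `(α^φ, ξ^φ)` to `(α, ξ)` defines a monomial automorphism. -/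
theorem exists_isMonomial_of_transforms {g : OneCochain S D} {φ : MulAut S}
    (hg : g.Transforms (TwoCocycle.pull φ c).1 c.1) :
    ∃ γ : RingAut (TwistedRing c), IsMonomial γ φ := by
  have hφ : ∀ u, autNz φ (autNz φ⁻¹ u) = u := fun u => Subtype.ext (φ.apply_symm_apply u)
  have hφ' : ∀ u, autNz φ⁻¹ (autNz φ u) = u := fun u => Subtype.ext (φ.symm_apply_apply u)
  -- This is d s ↦ μ_e(d) η(s) φ(s), written through the coefficient at u = φ(s).
  let T : TwistedRing c →+ TwistedRing c :=
    { toFun := fun x u => g.μ (lft (autNz φ⁻¹ u)) (x (autNz φ⁻¹ u)) * g.η (autNz φ⁻¹ u)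
      map_zero' := by ext u; simp [zero_apply]
      map_add' := fun x y => by ext u; simp only [add_apply, map_add, add_mul]; rfl }
  have hT : ∀ x u, T x u = g.μ (lft (autNz φ⁻¹ u)) (x (autNz φ⁻¹ u)) * g.η (autNz φ⁻¹ u) :=
    fun _ _ => rfl
  have hTs : ∀ s d, T (single c s d) = single c (autNz φ s) (g.μ (lft s) d * g.η s) := by
    intro s d
    ext u
    rw [hT]
    by_cases h : u = autNz φ s
    · subst h
      rw [hφ', single_same, single_same]
    · rw [single_of_ne h, single_of_ne, map_zero, zero_mul]
      rintro rfl
      exact h (hφ u).symm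
  have hTm : ∀ x y, T (x * y) = T x * T y := by
    intro x y
    -- Both sides are additive in each argument, so multiplicativity reduces to monomials, one
    -- argument at a time; there it follows from the two cochain conditions.
    have h1 : T.comp (AddMonoidHom.mulRight y) = (AddMonoidHom.mulRight (T y)).comp T := by
      refine addMonoidHom_ext fun s a => ?_
      have h2 : T.comp (AddMonoidHom.mulLeft (single c s a))
          = (AddMonoidHom.mulLeft (T (single c s a))).comp T := by
        refine addMonoidHom_ext fun t b => ?_
        show T (single c s a * single c t b) = T (single c s a) * T (single c t b)
        rw [hTs, hTs]
        by_cases hst : (s : S) * t = 0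
        · rw [single_mul_single_of_eq_zero hst, map_zero, single_mul_single_of_eq_zero]
          show φ s * φ t = 0
          rw [← map_mul, hst, aut_zero]
        · let p : Nz2 S := ⟨(s, t), hst⟩
          have h3 := single_mul_single (c := c) p a b
          have h4 := single_mul_single (c := c) (autNz2 φ p) (g.μ (lft s) a * g.η s)
            (g.μ (lft t) b * g.η t)
          have h5 := hg.unit p
          have h6 := hg.aut' s
          have h7 : lft t = rgt s := lft_snd p
          refine (congrArg T h3).trans (Eq.trans ?_ h4.symm)
          rw [hTs, autNz2_prod, lft_prod, map_mul, map_mul, h5]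
          congr 1
          have h8 : Nz2.fst p = s := rfl
          have h9 : Nz2.snd p = t := rfl
          rw [h8, h9, h6, h7]
          simp only [map_mul, mul_assoc, Units.inv_mul, mul_one, Units.inv_mul_cancel_left]
          rfl
      exact DFunLike.congr_fun h2 y
    exact DFunLike.congr_fun h1 x
  let T' : TwistedRing c → TwistedRing c := fun y s =>
    (g.μ (lft s)).symm (y (autNz φ s) * ((g.η s)⁻¹ : Dˣ))
  refine ⟨{ toFun := T, invFun := T', left_inv := ?_, right_inv := ?_, map_mul' := hTm,
            map_add' := map_add T }, fun s d => ⟨_, hTs s d⟩⟩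
  · intro x
    ext s
    show (g.μ (lft s)).symm (T x (autNz φ s) * ((g.η s)⁻¹ : Dˣ)) = x s
    rw [hT, hφ', Units.mul_inv_cancel_right, RingEquiv.symm_apply_apply]
  · intro y
    ext u
    rw [hT]
    show g.μ _ ((g.μ _).symm _) * _ = _
    rw [RingEquiv.apply_symm_apply, Units.inv_mul_cancel_right, hφ]

/-! ## Monomial automorphisms modulo inner automorphisms -/

theorem IsMonomial.mem_stabAut {γ : RingAut (TwistedRing c)} {φ : MulAut S}
    (hγ : IsMonomial γ φ) : φ ∈ stabAut c := by
  obtain ⟨g, hg, -⟩ := hγ.exists_oneCochain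
  exact Quotient.sound ⟨g⁻¹, hg.inv⟩

theorem exists_isMonomial_of_mem_stabAut {φ : MulAut S} (hφ : φ ∈ stabAut c) :
    ∃ γ : RingAut (TwistedRing c), IsMonomial γ φ := by
  obtain ⟨g, hg⟩ : Cohomologous c (TwoCocycle.pull φ c) := Quotient.exact hφ
  exact exists_isMonomial_of_transforms hg.inv

/-- Over φ = 1 the cochain of γ fixes c, so by H¹ = 1 it is the coboundary of some ε. Conjugation by
the diagonal unit with entries ε(e) sends d s to ε(e) d α_s(ε(f)⁻¹) s, which is the map that this
coboundary describes. -/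
theorem IsMonomial.mem_innAut (hH1 : Subsingleton (H1 c)) {γ : RingAut (TwistedRing c)}
    (hγ : IsMonomial γ 1) : γ ∈ innAut (TwistedRing c) := by
  obtain ⟨g, hg, hgγ⟩ := hγ.exists_oneCochain
  obtain ⟨ε, hε⟩ : (⟨g, hg⟩ : Z1 c) ∈ B1 c :=
    (QuotientGroup.eq_one_iff _).1 (Subsingleton.elim _ _)
  have hε' : g = coboundary c ε := hε
  let r : (TwistedRing c)ˣ := Units.map (diag c : _ →* _) (MulEquiv.piUnits.symm ε)
  have hr : (r : TwistedRing c) = diag c (fun e => (ε e : D)) := rfl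
  have hr' : ((r⁻¹ : (TwistedRing c)ˣ) : TwistedRing c) = diag c (fun e => ((ε e)⁻¹ : Dˣ)) := rfl
  refine ⟨r, fun x => ?_⟩
  have h1 : (γ : TwistedRing c →+ TwistedRing c) =
      (AddMonoidHom.mulRight ((r⁻¹ : (TwistedRing c)ˣ) : TwistedRing c)).comp
        (AddMonoidHom.mulLeft (r : TwistedRing c)) := by
    refine addMonoidHom_ext fun s d => ?_
    show γ (single c s d) = r * single c s d * ((r⁻¹ : (TwistedRing c)ˣ) : TwistedRing c)
    rw [hgγ, hr, hr', diag_mul_single, single_mul_diag, hε', coboundary_μ_apply]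
    have h2 : autNz 1 s = s := rfl
    rw [h2]
    simp [coboundary, mul_assoc]
  exact DFunLike.congr_fun h1 x

/-- Conjugation preserves the value 1 of the character at e on `corner c e 1`, whereas that
character vanishes on every other corner. So φ fixes E pointwise, and each s is determined by its
two ends. -/
theorem IsMonomial.eq_one (hS : IdempotentsIrreducible S) {γ : RingAut (TwistedRing c)}
    {φ : MulAut S} (hγ : IsMonomial γ φ) (h : γ ∈ innAut (TwistedRing c)) : φ = 1 := by
  obtain ⟨r, hr⟩ := h
  have h1 : ∀ e, autIdem φ e = e := by
    intro e
    by_contra hne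
    have h2 := congrArg (character c hS e) (hr (corner c e 1))
    rw [hγ.map_corner_one, character_corner_of_ne hS (Ne.symm hne), map_mul, map_mul,
      character_corner_same, mul_one, ← map_mul, Units.mul_inv, map_one] at h2
    exact zero_ne_one h2
  ext s
  by_cases hs : s = 0
  · rw [hs, aut_zero, aut_zero]
  · exact congrArg Subtype.val (eq_of_lft_rgt (s := autNz φ ⟨s, hs⟩) (t := ⟨s, hs⟩)
      (by rw [autIdem_lft, h1]) (by rw [autIdem_rgt, h1]))

/-! ### Straightening automorphisms and their action on S -/

/-- Every automorphism is inner-equivalent to one permuting the idempotents. -/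
theorem exists_innAut_mul_isMonomial (hS : IdempotentsIrreducible S)
    (γ : RingAut (TwistedRing c)) :
    ∃ δ ∈ innAut (TwistedRing c), ∃ φ, IsMonomial (δ * γ) φ := by
  classical
  have := Fintype.ofFinite (Idem S)
  let χ := character c hS
  let δ : Idem S → TwistedRing c := fun e => γ (corner c e 1)
  have hδi : ∀ e, δ e * δ e = δ e := fun e => by
    simp only [δ]; rw [← map_mul, isIdempotentElem_corner_one e]
  have hδo : ∀ e f, e ≠ f → δ e * δ f = 0 := fun e f hef => by
    simp only [δ]; rw [← map_mul, corner_one_mul_corner_one hef, map_zero]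
  have hδs : ∑ e, δ e = 1 := by
    simp only [δ]; rw [← map_sum, sum_corner_one, map_one]
  -- A character maps the δ e to orthogonal idempotents of D with sum 1, so exactly one of them, δ
  -- (σ e'), has value 1 and the others have value 0.
  have hσ : ∀ e', ∃ e, χ e' (δ e) ≠ 0 := by
    intro e'
    by_contra! hcon
    have h1 := congrArg (χ e') hδs
    rw [map_sum, Finset.sum_eq_zero (fun e _ => hcon e), map_one] at h1
    exact zero_ne_one h1
  choose σ hσ using hσ
  have hσ1 : ∀ e', χ e' (δ (σ e')) = 1 := fun e' => by
    have h1 := congrArg (χ e') (hδi (σ e'))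
    rw [map_mul] at h1
    exact mul_left_cancel₀ (hσ e') (h1.trans (mul_one _).symm)
  have hσ0 : ∀ e' e, e ≠ σ e' → χ e' (δ e) = 0 := fun e' e he => by
    have h1 := congrArg (χ e') (hδo e (σ e') he)
    rwa [map_mul, hσ1, mul_one, map_zero] at h1
  -- If σ missed e, every character would kill δ e, making it a nilpotent idempotent and hence 0.
  have hσs : Function.Surjective σ := by
    intro e
    by_contra! hcon
    have h1 : IsNilpotent (δ e) :=
      isNilpotent_of_character hS fun e' => hσ0 e' e (fun h => hcon e' h.symm)
    obtain ⟨n, hn⟩ := h1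
    have h2 : δ e ^ (n + 1) = δ e := IsIdempotentElem.pow_succ_eq n (hδi e)
    rw [pow_succ, hn, zero_mul] at h2
    have h3 := (map_eq_zero_iff γ γ.injective).1 h2.symm
    exact one_ne_zero (corner_injective e (h3.trans (corner_zero e).symm))
  have hσi : Function.Injective σ := Finite.injective_iff_surjective.2 hσs
  let π := Equiv.ofBijective σ ⟨hσi, hσs⟩
  -- This element intertwines the two systems: δ (σ e) u = u `corner c e 1`. All its characters
  -- equal 1, so u - 1 is nilpotent and u is a unit.
  let u : TwistedRing c := ∑ e, δ (σ e) * corner c e 1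
  have hu : IsUnit u := by
    have h1 : IsNilpotent (u - 1) := by
      refine isNilpotent_of_character hS fun e => ?_
      rw [map_sub, map_one, sub_eq_zero, map_sum, Finset.sum_eq_single e]
      · rw [map_mul, character_corner_same, mul_one]
        exact hσ1 e
      · intro f _ hf
        rw [map_mul, character_corner_of_ne hS (Ne.symm hf), mul_zero]
      · intro h
        exact absurd (Finset.mem_univ _) h
    simpa using h1.isUnit_one_add
  obtain ⟨v, hv⟩ := hu
  have hvl : ∀ e, δ (σ e) * u = δ (σ e) * corner c e 1 := by
    intro e
    rw [Finset.mul_sum, Finset.sum_eq_single e]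
    · rw [← mul_assoc, hδi]
    · intro f _ hf
      rw [← mul_assoc, hδo _ _ (fun h => hf (hσi h).symm), zero_mul]
    · intro h
      exact absurd (Finset.mem_univ _) h
  have hvr : ∀ e, u * corner c e 1 = δ (σ e) * corner c e 1 := by
    intro e
    rw [Finset.sum_mul, Finset.sum_eq_single e]
    · rw [mul_assoc, isIdempotentElem_corner_one e]
    · intro f _ hf
      rw [mul_assoc, corner_one_mul_corner_one hf, mul_zero]
    · intro h
      exact absurd (Finset.mem_univ _) h
  let ι : RingAut (TwistedRing c) :=
    MulSemiringAction.toRingAut (ConjAct (TwistedRing c)ˣ) _ (ConjAct.toConjAct v⁻¹)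
  have hι : ∀ x, ι x = ((v⁻¹ : (TwistedRing c)ˣ) : TwistedRing c) * x
      * ((v⁻¹⁻¹ : (TwistedRing c)ˣ) : TwistedRing c) := fun _ => rfl
  -- Conjugation by u⁻¹ takes δ (σ f) to the corner idempotent at f, so the corrected automorphism
  -- sends the one at σ f to the one at f: the permutation is σ⁻¹.
  refine ⟨ι, ⟨v⁻¹, hι⟩, exists_isMonomial (π := π.symm) π.symm.injective fun e => ?_⟩
  obtain ⟨f, rfl⟩ := π.surjective e
  rw [Equiv.symm_apply_apply, RingAut.mul_apply, hι, inv_inv, mul_assoc, Units.inv_mul_eq_iff_eq_mul,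
    hv, hvr]
  exact hvl f

/-- The outer action of an automorphism on the semigroup. -/
def InducesAut (γ : RingAut (TwistedRing c)) (φ : MulAut S) : Prop :=
  ∃ δ ∈ innAut (TwistedRing c), IsMonomial (δ * γ) φ

/-- Normality of Inn lets the inner correction of γ' move past γ. -/
theorem InducesAut.mul {γ γ' : RingAut (TwistedRing c)} {φ φ' : MulAut S} (h : InducesAut γ φ)
    (h' : InducesAut γ' φ') : InducesAut (γ * γ') (φ * φ') := by
  obtain ⟨δ, hδ, hm⟩ := h
  obtain ⟨δ', hδ', hm'⟩ := h'
  refine ⟨δ * (γ * δ' * γ⁻¹), mul_mem hδ (Subgroup.Normal.conj_mem inferInstance _ hδ' γ), ?_⟩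
  have := hm.mul hm'
  rwa [show δ * (γ * δ' * γ⁻¹) * (γ * γ') = δ * γ * (δ' * γ') by group]

/-- Two corrections of γ differ by an inner automorphism that is monomial over φφ'⁻¹, so
`IsMonomial.eq_one` applies. -/
theorem InducesAut.unique (hS : IdempotentsIrreducible S) {γ : RingAut (TwistedRing c)}
    {φ φ' : MulAut S} (h : InducesAut γ φ) (h' : InducesAut γ φ') : φ = φ' := by
  obtain ⟨δ, hδ, hm⟩ := h
  obtain ⟨δ', hδ', hm'⟩ := h'
  rw [← mul_inv_eq_one]
  refine (hm.mul hm'.inv).eq_one hS ?_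
  rw [show δ * γ * (δ' * γ)⁻¹ = δ * δ'⁻¹ by group]
  exact mul_mem hδ (inv_mem hδ')

/-- The first isomorphism theorem for γ ↦ φ; only the inclusion of the kernel in Inn needs H¹ = 1.
-/
theorem nonempty_out_equiv (hS : IdempotentsIrreducible S) (hH1 : Subsingleton (H1 c)) :
    Nonempty (Out (TwistedRing c) ≃* stabAut c) := by
  have h1 : ∀ γ : RingAut (TwistedRing c), ∃ φ : stabAut c, InducesAut γ φ := fun γ => by
    obtain ⟨δ, hδ, φ, hφ⟩ := exists_innAut_mul_isMonomial hS γ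
    exact ⟨⟨φ, hφ.mem_stabAut⟩, δ, hδ, hφ⟩
  choose F hF using h1
  let f : RingAut (TwistedRing c) →* stabAut c := MonoidHom.mk' F fun γ γ' =>
    Subtype.ext ((hF (γ * γ')).unique hS ((hF γ).mul (hF γ')))
  have hf : Function.Surjective f := by
    rintro ⟨φ, hφ⟩
    obtain ⟨γ, hγ⟩ := exists_isMonomial_of_mem_stabAut hφ
    exact ⟨γ, Subtype.ext ((hF γ).unique hS ⟨1, one_mem _, by rwa [one_mul]⟩)⟩
  have hker : innAut (TwistedRing c) = f.ker := by
    ext γ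
    obtain ⟨δ, hδ, hm⟩ := hF γ
    rw [MonoidHom.mem_ker]
    constructor
    · intro hγ
      exact Subtype.ext (hm.eq_one hS (mul_mem hδ hγ))
    · intro h
      have h2 : (F γ : MulAut S) = 1 := congrArg Subtype.val h
      rw [h2] at hm
      exact (Subgroup.mul_mem_cancel_left _ hδ).1 (hm.mem_innAut hH1)
  exact ⟨(QuotientGroup.quotientMulEquivOfEq hker).trans
    (QuotientGroup.quotientKerEquivOfSurjective f hf)⟩

end TwistedRing

/-! ### Transfer to R and the trivial class -/

/-- Isomorphic rings have isomorphic outer automorphism groups. -/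
theorem nonempty_out_congr {R R' : Type*} [Ring R] [Ring R'] (f : R ≃+* R') :
    Nonempty (Out R ≃* Out R') := by
  let F : RingAut R ≃* RingAut R' :=
    { toFun := fun γ => f.symm.trans (RingEquiv.trans γ f)
      invFun := fun γ => f.trans (RingEquiv.trans γ f.symm)
      left_inv := fun γ => RingEquiv.ext fun x => by simp
      right_inv := fun γ => RingEquiv.ext fun x => by simp
      map_mul' := fun γ δ => RingEquiv.ext fun x => by simp [RingAut.mul_apply] }
  have hF : ∀ γ x, F γ x = f (γ (f.symm x)) := fun _ _ => rfl
  refine ⟨QuotientGroup.congr _ _ F (le_antisymm ?_ ?_)⟩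
  · rintro _ ⟨γ, ⟨r, hr⟩, rfl⟩
    refine ⟨Units.mapEquiv (f : R ≃* R') r, fun x => ?_⟩
    show F γ x = f r * x * f ((r⁻¹ : Rˣ) : R)
    rw [hF, hr, map_mul, map_mul, RingEquiv.apply_symm_apply]
  · rintro γ ⟨r, hr⟩
    refine ⟨F.symm γ, ⟨Units.mapEquiv (f.symm : R' ≃* R) r, fun x => ?_⟩, F.apply_symm_apply γ⟩
    show f.symm (γ (f x)) = f.symm r * x * f.symm ((r⁻¹ : R'ˣ) : R')
    rw [hr, map_mul, map_mul, RingEquiv.symm_apply_apply]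

/-- The trivial cocycle is its own pullback along every φ, and pullback respects classes. -/
theorem stabAut_eq_top {S D : Type*} [SquareFreeSemigroup S] [DivisionRing D]
    {c : TwoCocycle S D} (hc : c.cls = (TwoCocycle.triv S D).cls) : stabAut c = ⊤ := by
  refine (Subgroup.eq_top_iff' _).2 fun φ => ?_
  have h : Cohomologous c (TwoCocycle.triv S D) := Quotient.exact hc
  exact hc.trans (Quotient.sound (h.pull φ)).symm

theorem mainTheorem3 {S D R : Type*} [SquareFreeSemigroup S] [DivisionRing D] [Ring R]
    (c : TwoCocycle S D)
    (hR : IsSquareFreeRing R)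
    (hiso : Nonempty (R ≃+* TwistedRing c))
    (hH1 : Subsingleton (H1 c)) :
    Nonempty (Out R ≃* stabAut c) ∧
      (c.cls = (TwoCocycle.triv S D).cls → Nonempty (Out R ≃* MulAut S)) := by
  obtain ⟨f⟩ := hiso
  obtain ⟨a⟩ := nonempty_out_congr f
  obtain ⟨b⟩ := TwistedRing.nonempty_out_equiv
    (TwistedRing.idempotentsIrreducible_of_isBasicRing hR.basic f) hH1
  refine ⟨⟨a.trans b⟩, fun hc => ⟨(a.trans b).trans ?_⟩⟩
  exact (MulEquiv.subgroupCongr (stabAut_eq_top hc)).trans Subgroup.topEquiv
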